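/- A diffeological group is a group $G$ with a diffeology for which multiplication and inversion are smooth. Open sets of a diffeological space are always those of its D-topology. Subsets (in particular $[0,1]\subseteq\mathbb R$), products, and quotients carry the subset, product and quotient diffeologies. **Bundles.** For smooth maps $\pi:E\to X$ and $f:Y\to X$ put $f^*E=\{(y,e)\in Y\times E : f(y)=\pi(e)\}$. The map $\pi$ is trivial with fibre $F$ if there is a diffeomorphism $E\cong X\times F$ over $X$; it is locally trivial if there are a fibre $F$ and an open cover of $X$ such that the restriction of $\pi$ to each member of the cover is trivial with fibre $F$ (a local trivialisation). A diffeological fibre bundle is a smooth surjection $\pi:E\to X$ such that $p^*E\to U$ is locally trivial for every plot $p:U\to X$. It is a principal $G$-bundle if it is given with a smooth, fibre-preserving action of $G$ on $E$ such that, for every plot $p:U\to X$ and every $u\in U$, there are an open neighbourhood $V$ of $u$ and a plot $q:V\to E$ with $\pi\circ q=p|_V$ for which $(v,g)\mapsto (v,g\cdot q(v))$ is a ($G$-equivariant) diffeomorphism $V\times G\to (p|_V)^*E$. A smooth partition of unity is a family of smooth functions $\zeta_i:X\to[0,1]$, only finitely many of them non-zero at each point, with $\sum_i\zeta_i=1$;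 it is subordinate to $\{U_i\}$ if $\operatorname{supp}\zeta_i\subseteq U_i$ for each $i$. A bundle over $X$ is D-numerable if it has a local trivialisation over a locally finite open cover $\{U_i\}_{i\in\mathbb N}$ of $X$ to which some smooth partition of unity $\{\zeta_i\}_{i\in\mathbb N}$ is subordinate. Let $\mathcal B_G(X)$ be the set of isomorphism classes of D-numerable principal $G$-bundles over $X$, where isomorphisms are $G$-equivariant diffeomorphisms over $X$; it is a contravariant functor of $X$ by pullback of bundles. **Classifying space.** Let $S_G\subseteq [0,1]^{\mathbb N}\times G^{\mathbb N}$ be the set of all $(t_i,g_i)_{i\in\mathbb N}$ with only finitely many $t_i\ne0$ and $\sum_i t_i=1$. Let $EG=S_G/\!\sim$, where $(t_i,g_i)\sim(t_i',g_i')$ if $t_i=t_i'$ for all $i$ and $g_i=g_i'$ whenever $t_i\neq 0$. The group $G$ acts on $EG$ by $h\cdot(t_ig_i)=(t_ig_ih^{-1})$; let $BG=EG/G$ be the diffeological Milnor classifying space. Let $[X,BG]$ be the set of smooth homotopy classes of smooth maps $X\to BG$; it is a contravariant functor of $X$ by precomposition. **Spaces.** A diffeological space is smoothly paracompact if its D-topology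 is paracompact (every open cover has a locally finite open refinement) and every open cover has a (locally finite) smooth partition of unity subordinate to it. Let $\mathbf{Diffeol}_{\mathrm{HSP}}$ be the full subcategory of the category of diffeological spaces and smooth maps on those whose D-topology is Hausdorff and second-countable and which are smoothly paracompact. **Theorem.** For every diffeological group $G$, the contravariant functors $\mathcal B_G(\cdot)$ and $[\cdot,BG]$ from $\mathbf{Diffeol}_{\mathrm{HSP}}$ to $\mathbf{Set}$ are naturally isomorphic. -/

import Mathlib

open Diffeology
open scoped Topology

universe u v w

noncomputable section

namespace MilnorBG

/-! ### Subset, product and quotient diffeologies -/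

section Constructions

variable {X : Type*} {Y : Type*}

/-- The pullback (initial) diffeology along a map `f`: the plots are the maps whose composition
with `f` is a plot. -/
@[reducible]
def inducedDiffeology (f : X → Y) [DiffeologicalSpace Y] : DiffeologicalSpace X where
  plots n := {p : EuclideanSpace ℝ (Fin n) → X | IsPlot (f ∘ p)}
  constant_plots x := isPlot_const (x := f x)
  plot_reparam hp hf := isPlot_reparam hp hf
  locality {n p} h := DiffeologicalSpace.locality (p := f ∘ p) h

/-- The subset diffeology. -/
instance subtypeDiffeology [DiffeologicalSpace X] (P : X → Prop) :
    DiffeologicalSpace (Subtype P) :=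
  inducedDiffeology Subtype.val

/-- The product diffeology on an arbitrary product: the plots are the maps all of whose
components are plots. -/
instance piDiffeology {ι : Type*} {Z : ι → Type*} [∀ i, DiffeologicalSpace (Z i)] :
    DiffeologicalSpace (∀ i, Z i) where
  plots n := {p : EuclideanSpace ℝ (Fin n) → ∀ i, Z i | ∀ i, IsPlot fun x => p x i}
  constant_plots x := fun i => isPlot_const (x := x i)
  plot_reparam hp hf := fun i => isPlot_reparam (hp i) hf
  locality {n p} h := fun i => DiffeologicalSpace.locality (p := fun x => p x i) fun x => by
    obtain ⟨u, hu, hxu, hu'⟩ := h x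
    exact ⟨u, hu, hxu, fun hfu hf => hu' hfu hf i⟩

/-- The product diffeology on a binary product. -/
instance prodDiffeology [DiffeologicalSpace X] [DiffeologicalSpace Y] :
    DiffeologicalSpace (X × Y) where
  plots n := {p : EuclideanSpace ℝ (Fin n) → X × Y |
    (IsPlot fun x => (p x).1) ∧ IsPlot fun x => (p x).2}
  constant_plots x := ⟨isPlot_const (x := x.1), isPlot_const (x := x.2)⟩
  plot_reparam hp hf := ⟨isPlot_reparam hp.1 hf, isPlot_reparam hp.2 hf⟩
  locality {n p} h := by
    refine ⟨DiffeologicalSpace.locality (p := fun x => (p x).1) fun x => ?_,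
      DiffeologicalSpace.locality (p := fun x => (p x).2) fun x => ?_⟩
    · obtain ⟨u, hu, hxu, hu'⟩ := h x
      exact ⟨u, hu, hxu, fun hfu hf => (hu' hfu hf).1⟩
    · obtain ⟨u, hu, hxu, hu'⟩ := h x
      exact ⟨u, hu, hxu, fun hfu hf => (hu' hfu hf).2⟩

/-- Every open neighbourhood of a point of `ℝⁿ` contains the image of a smooth self-map of `ℝⁿ`
that is the identity near the point. -/
theorem exists_smooth_localization {n : ℕ} {u : Set (EuclideanSpace ℝ (Fin n))} (hu : IsOpen u)
    {x : EuclideanSpace ℝ (Fin n)} (hx : x ∈ u) :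
    ∃ f : EuclideanSpace ℝ (Fin n) → EuclideanSpace ℝ (Fin n), ContDiff ℝ (⊤ : ℕ∞) f ∧
      (∀ y, f y ∈ u) ∧ ∃ v, IsOpen v ∧ x ∈ v ∧ ∀ y ∈ v, f y = y := by
  obtain ⟨ε, hε, hεu⟩ := Metric.isOpen_iff.mp hu x hx
  let χ : ContDiffBump x := ⟨ε / 2, ε, by linarith, by linarith⟩
  refine ⟨fun y => x + χ y • (y - x), ?_, fun y => hεu ?_, Metric.ball x (ε / 2),
    Metric.isOpen_ball, Metric.mem_ball_self (by linarith), fun y hy => ?_⟩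
  · exact contDiff_const.add (χ.contDiff.smul (contDiff_id.sub contDiff_const))
  · rw [Metric.mem_ball, dist_eq_norm, add_sub_cancel_left, norm_smul, Real.norm_eq_abs,
      abs_of_nonneg χ.nonneg]
    by_cases hy : y ∈ Metric.ball x ε
    · rw [Metric.mem_ball, dist_eq_norm] at hy
      exact lt_of_le_of_lt (mul_le_of_le_one_left (norm_nonneg _) χ.le_one) hy
    · have h0 : χ y = 0 := χ.zero_of_le_dist (by simpa using hy)
      simpa [h0] using hε
  · have h1 : χ y = 1 := χ.one_of_mem_closedBall (Metric.ball_subset_closedBall hy)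
    simp [h1]

/-- The quotient diffeology: the plots are the maps that lift locally to plots along the
projection. -/
instance quotientDiffeology [DiffeologicalSpace X] (s : Setoid X) :
    DiffeologicalSpace (Quotient s) where
  plots n := {p : EuclideanSpace ℝ (Fin n) → Quotient s | ∀ x, ∃ v, IsOpen v ∧ x ∈ v ∧
    ∃ q : EuclideanSpace ℝ (Fin n) → X, IsPlot q ∧ ∀ y ∈ v, p y = Quotient.mk s (q y)}
  constant_plots x := fun y => ⟨Set.univ, isOpen_univ, Set.mem_univ y, fun _ => x.out,
    isPlot_const, fun _ _ => (Quotient.out_eq x).symm⟩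
  plot_reparam {n m p f} hp hf := fun x => by
    obtain ⟨v, hv, hxv, q, hq, hqv⟩ := hp (f x)
    exact ⟨f ⁻¹' v, hv.preimage hf.continuous, hxv, q ∘ f, isPlot_reparam hq hf,
      fun y hy => hqv (f y) hy⟩
  locality {n p} h := fun x => by
    obtain ⟨u, hu, hxu, hu'⟩ := h x
    obtain ⟨f, hf, hfu, v, hv, hxv, hfv⟩ := exists_smooth_localization hu hxu
    obtain ⟨w, hw, hxw, q, hq, hqw⟩ := hu' hfu hf x
    refine ⟨v ∩ w, hv.inter hw, ⟨hxv, hxw⟩, q, hq, fun y hy => ?_⟩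
    rw [← hqw y hy.2, Function.comp_apply, hfv y hy.1]

end Constructions

/-! ### Elementary facts on smooth maps -/

section Smooth

variable {X : Type*} {Y : Type*} {Z : Type*} [DiffeologicalSpace X] [DiffeologicalSpace Y]
  [DiffeologicalSpace Z]

theorem smooth_fst : DSmooth (Prod.fst : X × Y → X) := fun _ _ hp => hp.1

theorem smooth_snd : DSmooth (Prod.snd : X × Y → Y) := fun _ _ hp => hp.2

theorem smooth_pair {f : Z → X} {g : Z → Y} (hf : DSmooth f) (hg : DSmooth g) :
    DSmooth fun z => (f z, g z) := fun n p hp => ⟨hf n p hp, hg n p hp⟩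

theorem smooth_val {P : X → Prop} : DSmooth (Subtype.val : Subtype P → X) := fun _ _ hp => hp

theorem smooth_subtype {P : Y → Prop} {f : X → Subtype P} (hf : DSmooth fun x => (f x).1) :
    DSmooth f := fun n p hp => hf n p hp

end Smooth

/-! ### Diffeomorphisms -/

/-- A diffeomorphism of diffeological spaces. -/
structure Diffeo (X : Type v) (Y : Type w) [DiffeologicalSpace X] [DiffeologicalSpace Y]
    extends X ≃ Y where
  smooth_toFun : DSmooth toFun
  smooth_invFun : DSmooth invFun

namespace Diffeo

variable {X : Type*} {Y : Type*} {Z : Type*} [DiffeologicalSpace X] [DiffeologicalSpace Y]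
  [DiffeologicalSpace Z]

/-- The identity diffeomorphism. -/
def refl (X : Type*) [DiffeologicalSpace X] : Diffeo X X :=
  ⟨Equiv.refl X, dSmooth_id, dSmooth_id⟩

/-- The inverse diffeomorphism. -/
def symm (e : Diffeo X Y) : Diffeo Y X := ⟨e.toEquiv.symm, e.smooth_invFun, e.smooth_toFun⟩

/-- The composition of two diffeomorphisms. -/
def trans (e : Diffeo X Y) (e' : Diffeo Y Z) : Diffeo X Z :=
  ⟨e.toEquiv.trans e'.toEquiv, e'.smooth_toFun.comp e.smooth_toFun,
    e.smooth_invFun.comp e'.smooth_invFun⟩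

end Diffeo

/-! ### Diffeological fibre bundles -/

/-- The pullback `f^*E = {(y, e) ∈ Y × E | f y = π e}` of `π : E → X` along `f : Y → X`, with
the subset diffeology of the product. -/
abbrev Pullback {X : Type*} {Y : Type*} {E : Type*} (f : Y → X) (π : E → X) :=
  {z : Y × E // f z.1 = π z.2}

/-- The projection `f^*E → Y`. -/
abbrev Pullback.proj {X : Type*} {Y : Type*} {E : Type*} (f : Y → X) (π : E → X) :
    Pullback f π → Y := fun z => z.1.1

section Bundles

variable {X : Type u} {E : Type v} [DiffeologicalSpace X] [DiffeologicalSpace E]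

/-- `π : E → X` is trivial with fibre `F`. -/
def IsTrivial (π : E → X) (F : Type w) [DiffeologicalSpace F] : Prop :=
  ∃ φ : Diffeo E (X × F), ∀ e, (φ.toEquiv e).1 = π e

/-- The restriction of `π : E → X` to the subset `U`, that is, its pullback along the inclusion
of `U`, is trivial with fibre `F`. -/
def IsTrivialOver (π : E → X) (U : Set X) (F : Type w) [DiffeologicalSpace F] : Prop :=
  IsTrivial (Pullback.proj (Subtype.val : U → X) π) F

/-- `π : E → X` is locally trivial: there are a fibre `F` and a cover of `X` by D-open sets over
each of which `π` is trivial with fibre `F`. -/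
def IsLocallyTrivial (π : E → X) : Prop :=
  ∃ (F : Type v) (_ : DiffeologicalSpace F),
    ∀ x, ∃ U : Set X, IsOpen[dTopology] U ∧ x ∈ U ∧ IsTrivialOver π U F

/-- `π : E → X` is a diffeological fibre bundle: a smooth surjection whose pullback along each
plot of `X` is locally trivial. -/
structure IsFibreBundle (π : E → X) : Prop where
  smooth : DSmooth π
  surjective : Function.Surjective π
  locallyTrivial : ∀ (n : ℕ) (p : EuclideanSpace ℝ (Fin n) → X), IsPlot p →
    IsLocallyTrivial (Pullback.proj p π)

/-- A pointwise-finite smooth partition of unity on `X`. -/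
structure IsSmoothPartitionOfUnity {ι : Type*} (ζ : ι → X → ℝ) : Prop where
  smooth : ∀ i, DSmooth (ζ i)
  nonneg : ∀ i x, 0 ≤ ζ i x
  pointFinite : ∀ x, {i | ζ i x ≠ 0}.Finite
  sum_eq_one : ∀ x, ∑ᶠ i, ζ i x = 1

/-- The support of a function on a diffeological space: the closure of its non-vanishing set in
the D-topology. -/
def dSupport (f : X → ℝ) : Set X := closure[dTopology] {x | f x ≠ 0}

/-- `π : E → X` is D-numerable: it has a countable local trivialisation over a locally finite
D-open cover `U`, and there is a smooth partition of unity on `X` subordinate to `U`. -/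
def IsDNumerable (π : E → X) : Prop :=
  ∃ (F : Type v) (_ : DiffeologicalSpace F) (U : ℕ → Set X) (ζ : ℕ → X → ℝ),
    (∀ i, IsOpen[dTopology] (U i)) ∧ (⋃ i, U i = Set.univ) ∧ (∀ i, IsTrivialOver π (U i) F) ∧
    @LocallyFinite ℕ X dTopology U ∧
    IsSmoothPartitionOfUnity ζ ∧ ∀ i, dSupport (ζ i) ⊆ U i

end Bundles

/-! ### Principal bundles -/

/-- A diffeological group. -/
class DiffeologicalGroup (G : Type u) [Group G] [DiffeologicalSpace G] : Prop where
  smooth_mul : DSmooth fun p : G × G => p.1 * p.2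
  smooth_inv : DSmooth fun g : G => g⁻¹

/-- `π : E → X` is a principal `G`-bundle for the given action of `G` on `E`: it is a
diffeological fibre bundle, the action is smooth and preserves the fibres, and for each plot
`p` of `X` and each point `a` of its domain there are an open neighbourhood `V` of `a`, a plot
`q : V → E` over `p`, and a diffeomorphism `V × G → (p|V)^*E` given by `(v, g) ↦ (v, g • q v)`
(by this formula, it is equivariant). -/
structure IsPrincipalBundle (G : Type u) [Group G] [DiffeologicalSpace G]
    {X : Type v} {E : Type w} [DiffeologicalSpace X] [DiffeologicalSpace E] [MulAction G E]
    (π : E → X) : Prop extends IsFibreBundle π where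
  smooth_smul : DSmooth fun z : G × E => z.1 • z.2
  proj_smul : ∀ (g : G) (e : E), π (g • e) = π e
  equivariantlyTrivial : ∀ (n : ℕ) (p : EuclideanSpace ℝ (Fin n) → X), IsPlot p →
    ∀ a : EuclideanSpace ℝ (Fin n), ∃ V : Set (EuclideanSpace ℝ (Fin n)), IsOpen V ∧ a ∈ V ∧
      ∃ q : V → E, DSmooth q ∧ (∀ v : V, π (q v) = p v) ∧
        ∃ ψ : Diffeo (V × G) (Pullback (fun v : V => p v) π),
          ∀ (v : V) (g : G), (ψ.toEquiv (v, g)).1 = (v, g • q v)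

/-- A D-numerable principal `G`-bundle over `X`. -/
structure DNumerableBundle (G : Type u) [Group G] [DiffeologicalSpace G]
    (X : Type u) [DiffeologicalSpace X] where
  /-- The total space. -/
  total : Type u
  [diffeology : DiffeologicalSpace total]
  [action : MulAction G total]
  /-- The projection. -/
  proj : total → X
  isPrincipal : IsPrincipalBundle G proj
  isDNumerable : IsDNumerable proj

attribute [instance] DNumerableBundle.diffeology DNumerableBundle.action

/-! ### Pulling back bundles -/

section PullbackFacts

variable {X : Type*} {Y : Type*} {Z : Type*} {E : Type v} {E' : Type w}
  [DiffeologicalSpace X] [DiffeologicalSpace Y] [DiffeologicalSpace Z]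
  [DiffeologicalSpace E] [DiffeologicalSpace E']

/-- A bundle diffeomorphism over the base induces one of the pullbacks. -/
def pullbackCongr (f : Y → X) {π : E → X} {π' : E' → X} (Φ : Diffeo E E')
    (h : ∀ e, π' (Φ.toEquiv e) = π e) : Diffeo (Pullback f π) (Pullback f π') where
  toFun z := ⟨(z.1.1, Φ.toEquiv z.1.2), z.2.trans (h _).symm⟩
  invFun z := ⟨(z.1.1, Φ.toEquiv.symm z.1.2),
    z.2.trans (by rw [← h, Equiv.apply_symm_apply])⟩
  left_inv z := by simp
  right_inv z := by simp
  smooth_toFun := smooth_subtype (smooth_pair (smooth_fst.comp smooth_val)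
    (Φ.smooth_toFun.comp (smooth_snd.comp smooth_val)))
  smooth_invFun := smooth_subtype (smooth_pair (smooth_fst.comp smooth_val)
    (Φ.smooth_invFun.comp (smooth_snd.comp smooth_val)))

/-- The pullback along `f ∘ g` is the pullback along `g` of the pullback along `f`. -/
def pullbackComp (g : Z → Y) (hg : DSmooth g) (f : Y → X) (π : E → X) :
    Diffeo (Pullback (fun z => f (g z)) π) (Pullback g (Pullback.proj f π)) where
  toFun z := ⟨(z.1.1, ⟨(g z.1.1, z.1.2), z.2⟩), rfl⟩
  invFun z := ⟨(z.1.1, z.1.2.1.2), (congrArg f z.2).trans z.1.2.2⟩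
  left_inv z := rfl
  right_inv z := by
    obtain ⟨⟨a, ⟨⟨b, e⟩, h⟩⟩, h'⟩ := z
    obtain rfl : g a = b := h'
    rfl
  smooth_toFun := smooth_subtype (smooth_pair (smooth_fst.comp smooth_val)
    (smooth_subtype (smooth_pair (hg.comp (smooth_fst.comp smooth_val))
      (smooth_snd.comp smooth_val))))
  smooth_invFun := smooth_subtype (smooth_pair (smooth_fst.comp smooth_val)
    (smooth_snd.comp (smooth_val.comp (smooth_snd.comp smooth_val))))

/-- The pullback along the identity. -/
def pullbackId (π : E → X) (hπ : DSmooth π) : Diffeo (Pullback (fun x => x) π) E where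
  toFun z := z.1.2
  invFun e := ⟨(π e, e), rfl⟩
  left_inv z := by
    obtain ⟨⟨x, e⟩, h⟩ := z
    obtain rfl : x = π e := h
    rfl
  right_inv e := rfl
  smooth_toFun := smooth_snd.comp smooth_val
  smooth_invFun := smooth_subtype (smooth_pair hπ dSmooth_id)

theorem IsTrivial.congr {π : E → X} {π' : E' → X} {F : Type*} [DiffeologicalSpace F]
    (h : IsTrivial π F) (Φ : Diffeo E E') (hΦ : ∀ e, π' (Φ.toEquiv e) = π e) :
    IsTrivial π' F := by
  obtain ⟨φ, hφ⟩ := h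
  refine ⟨Φ.symm.trans φ, fun e => ?_⟩
  have := hΦ (Φ.toEquiv.symm e)
  rw [Equiv.apply_symm_apply] at this
  exact (hφ _).trans this.symm

theorem IsTrivialOver.congr {π : E → X} {π' : E' → X} {U : Set X} {F : Type*}
    [DiffeologicalSpace F] (h : IsTrivialOver π U F) (Φ : Diffeo E E')
    (hΦ : ∀ e, π' (Φ.toEquiv e) = π e) : IsTrivialOver π' U F :=
  IsTrivial.congr h (pullbackCongr _ Φ hΦ) fun _ => rfl

theorem IsTrivial.pullback {π : E → X} {F : Type*} [DiffeologicalSpace F]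
    (h : IsTrivial π F) {f : Y → X} (hf : DSmooth f) : IsTrivial (Pullback.proj f π) F := by
  obtain ⟨φ, hφ⟩ := h
  refine ⟨{ toFun := fun z => (z.1.1, (φ.toEquiv z.1.2).2)
            invFun := fun z => ⟨(z.1, φ.toEquiv.symm (f z.1, z.2)), ?_⟩
            left_inv := ?_
            right_inv := ?_
            smooth_toFun := ?_
            smooth_invFun := ?_ }, fun _ => rfl⟩
  · rw [← hφ, Equiv.apply_symm_apply]
  · rintro ⟨⟨y, e⟩, h⟩
    have : (f y, (φ.toEquiv e).2) = φ.toEquiv e := Prod.ext (h.trans (hφ e).symm) rfl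
    simp only [this, Equiv.symm_apply_apply]
  · rintro ⟨y, a⟩
    simp
  · exact smooth_pair (smooth_fst.comp smooth_val)
      (smooth_snd.comp (φ.smooth_toFun.comp (smooth_snd.comp smooth_val)))
  · exact smooth_subtype (smooth_pair smooth_fst
      (φ.smooth_invFun.comp (smooth_pair (hf.comp smooth_fst) smooth_snd)))

theorem IsTrivialOver.pullback {π : E → X} {U : Set X} {F : Type*} [DiffeologicalSpace F]
    (h : IsTrivialOver π U F) {f : Y → X} (hf : DSmooth f) :
    IsTrivialOver (Pullback.proj f π) (f ⁻¹' U) F := by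
  let r : (f ⁻¹' U : Set Y) → U := fun y => ⟨f y.1, y.2⟩
  have hr : DSmooth r := smooth_subtype (hf.comp smooth_val)
  have h1 := IsTrivial.pullback h hr
  exact (h1.congr (pullbackComp r hr Subtype.val π).symm (fun _ => rfl)).congr
    (pullbackComp Subtype.val smooth_val f π) fun _ => rfl

theorem IsLocallyTrivial.congr {π : E → X} {E' : Type v} [DiffeologicalSpace E'] {π' : E' → X}
    (h : IsLocallyTrivial π) (Φ : Diffeo E E') (hΦ : ∀ e, π' (Φ.toEquiv e) = π e) :
    IsLocallyTrivial π' := by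
  obtain ⟨F, dF, hF⟩ := h
  refine ⟨F, dF, fun x => ?_⟩
  obtain ⟨U, hU, hxU, hUF⟩ := hF x
  exact ⟨U, hU, hxU, hUF.congr Φ hΦ⟩

theorem isOpen_preimage {f : Y → X} (hf : DSmooth f) {U : Set X} (hU : IsOpen[dTopology] U) :
    IsOpen[dTopology] (f ⁻¹' U) :=
  @IsOpen.preimage Y X dTopology dTopology f hf.continuous U hU

end PullbackFacts

section PullbackBundle

variable {X Y Z : Type u} {E : Type u} [DiffeologicalSpace X] [DiffeologicalSpace Y]
  [DiffeologicalSpace Z] [DiffeologicalSpace E]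

theorem IsFibreBundle.pullback {π : E → X} (h : IsFibreBundle π) {f : Y → X} (hf : DSmooth f) :
    IsFibreBundle (Pullback.proj f π) where
  smooth := smooth_fst.comp smooth_val
  surjective y := by
    obtain ⟨e, he⟩ := h.surjective (f y)
    exact ⟨⟨(y, e), he.symm⟩, rfl⟩
  locallyTrivial n p hp :=
    (h.locallyTrivial n (f ∘ p) (hf n p hp)).congr (pullbackComp p hp.dSmooth f π) fun _ => rfl

theorem IsDNumerable.pullback {π : E → X} (h : IsDNumerable π) {f : Y → X} (hf : DSmooth f) :
    IsDNumerable (Pullback.proj f π) := by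
  obtain ⟨F, dF, U, ζ, hU, hcov, htriv, hfin, hζ, hsupp⟩ := h
  refine ⟨F, dF, fun i => f ⁻¹' U i, fun i => ζ i ∘ f, fun i => isOpen_preimage hf (hU i), ?_,
    fun i => (htriv i).pullback hf, ?_, ?_, fun i => ?_⟩
  · rw [← Set.preimage_iUnion, hcov, Set.preimage_univ]
  · exact @LocallyFinite.preimage_continuous ℕ X Y dTopology dTopology U f hfin hf.continuous
  · exact ⟨fun i => (hζ.smooth i).comp hf, fun i y => hζ.nonneg i (f y),
      fun y => hζ.pointFinite (f y), fun y => hζ.sum_eq_one (f y)⟩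
  · exact (@Continuous.closure_preimage_subset Y X dTopology dTopology f hf.continuous
      {x | ζ i x ≠ 0}).trans (Set.preimage_mono (hsupp i))

variable {G : Type u} [Group G] [DiffeologicalSpace G]

namespace DNumerableBundle

/-- The action `g • (y, e) = (y, g • e)` on the pullback of a principal bundle. -/
instance pullbackAction (P : DNumerableBundle G X) (f : Y → X) :
    MulAction G (Pullback f P.proj) where
  smul g z := ⟨(z.1.1, g • z.1.2), z.2.trans (P.isPrincipal.proj_smul g _).symm⟩
  one_smul z := Subtype.ext (Prod.ext rfl (one_smul G z.1.2))
  mul_smul g h z := Subtype.ext (Prod.ext rfl (mul_smul g h z.1.2))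

/-- The pullback of a D-numerable principal bundle along a smooth map. -/
def pullback (P : DNumerableBundle G X) (f : Y → X) (hf : DSmooth f) :
    DNumerableBundle G Y where
  total := Pullback f P.proj
  proj := Pullback.proj f P.proj
  isDNumerable := P.isDNumerable.pullback hf
  isPrincipal :=
    { P.isPrincipal.toIsFibreBundle.pullback hf with
      smooth_smul := smooth_subtype (smooth_pair
        (smooth_fst.comp (smooth_val.comp smooth_snd))
        (P.isPrincipal.smooth_smul.comp
          (smooth_pair smooth_fst (smooth_snd.comp (smooth_val.comp smooth_snd)))))
      proj_smul := fun _ _ => rfl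
      equivariantlyTrivial := fun n p hp a => by
        obtain ⟨V, hV, haV, q, hq, hqp, ψ, hψ⟩ :=
          P.isPrincipal.equivariantlyTrivial n (f ∘ p) (hf n p hp) a
        have hpV : DSmooth fun v : V => p v := hp.dSmooth.comp smooth_val
        refine ⟨V, hV, haV, fun v => ⟨(p v, q v), (hqp v).symm⟩,
          smooth_subtype (smooth_pair hpV hq), fun v => rfl,
          ψ.trans (pullbackComp (fun v : V => p v) hpV f P.proj), fun v g => ?_⟩
        have h1 := congrArg Prod.fst (hψ v g)
        have h2 := congrArg Prod.snd (hψ v g)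
        exact Prod.ext h1 (Subtype.ext (Prod.ext (congrArg (fun v : V => p v) h1) h2)) }

/-- Two principal `G`-bundles over `X` are isomorphic: there is a `G`-equivariant diffeomorphism
of the total spaces over `X`. -/
def IsIso (P Q : DNumerableBundle G X) : Prop :=
  ∃ Φ : Diffeo P.total Q.total, (∀ e, Q.proj (Φ.toEquiv e) = P.proj e) ∧
    ∀ (g : G) (e : P.total), Φ.toEquiv (g • e) = g • Φ.toEquiv e

variable (X G) in
/-- Isomorphism of D-numerable principal `G`-bundles over `X`, as an equivalence relation. -/
instance isoSetoid : Setoid (DNumerableBundle G X) where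
  r := IsIso
  iseqv :=
    { refl := fun P => ⟨Diffeo.refl P.total, fun _ => rfl, fun _ _ => rfl⟩
      symm := by
        rintro P Q ⟨Φ, h1, h2⟩
        refine ⟨Φ.symm, fun e => ?_, fun g e => ?_⟩
        · have := h1 (Φ.toEquiv.symm e)
          rw [Equiv.apply_symm_apply] at this
          exact this.symm
        · apply Φ.toEquiv.injective
          change Φ.toEquiv (Φ.toEquiv.symm (g • e)) = Φ.toEquiv (g • Φ.toEquiv.symm e)
          rw [h2, Equiv.apply_symm_apply, Equiv.apply_symm_apply]
      trans := by
        rintro P Q R ⟨Φ, h1, h2⟩ ⟨Ψ, k1, k2⟩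
        exact ⟨Φ.trans Ψ, fun e => (k1 _).trans (h1 e),
          fun g e => (congrArg Ψ.toEquiv (h2 g e)).trans (k2 g _)⟩ }

theorem pullback_congr {P Q : DNumerableBundle G X} (h : P ≈ Q) {f : Y → X} (hf : DSmooth f) :
    P.pullback f hf ≈ Q.pullback f hf := by
  obtain ⟨Φ, h1, h2⟩ := h
  exact ⟨pullbackCongr f Φ h1, fun _ => rfl,
    fun g e => Subtype.ext (Prod.ext rfl (h2 g e.1.2))⟩

theorem pullback_id (P : DNumerableBundle G X) : P.pullback (fun x => x) dSmooth_id ≈ P :=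
  ⟨pullbackId P.proj P.isPrincipal.smooth, fun e => e.2.symm, fun _ _ => rfl⟩

theorem pullback_comp (P : DNumerableBundle G X) {f : Y → X} (hf : DSmooth f) {g : Z → Y}
    (hg : DSmooth g) :
    P.pullback (fun z => f (g z)) (hf.comp hg) ≈ (P.pullback f hf).pullback g hg :=
  ⟨pullbackComp g hg f P.proj, fun _ => rfl, fun _ _ => rfl⟩

end DNumerableBundle

/-- The set `ℬ_G(X)` of isomorphism classes of D-numerable principal `G`-bundles over `X`. -/
def BundleClasses (G : Type u) [Group G] [DiffeologicalSpace G] (X : Type u)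
    [DiffeologicalSpace X] : Type (u + 1) := Quotient (DNumerableBundle.isoSetoid X G)

/-- Pullback of isomorphism classes of bundles. -/
def BundleClasses.pullback (f : Y → X) (hf : DSmooth f) :
    BundleClasses G X → BundleClasses G Y :=
  Quotient.map (fun P => P.pullback f hf) fun _ _ h => DNumerableBundle.pullback_congr h hf

end PullbackBundle

/-! ### Smooth homotopy classes -/

section Homotopy

/-- Smooth homotopy of smooth maps. -/
def SmoothHomotopic {X : Type u} {Y : Type v} [DiffeologicalSpace X] [DiffeologicalSpace Y]
    (f g : {f : X → Y // DSmooth f}) : Prop :=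
  ∃ H : X × ℝ → Y, DSmooth H ∧ (∀ x, H (x, 0) = f.1 x) ∧ ∀ x, H (x, 1) = g.1 x

/-- The set `[X, Y]` of smooth homotopy classes of smooth maps. -/
def HomotopyClasses (X : Type u) (Y : Type v) [DiffeologicalSpace X] [DiffeologicalSpace Y] :=
  Quot (SmoothHomotopic (X := X) (Y := Y))

/-- Precomposition of homotopy classes with a smooth map. -/
def HomotopyClasses.precomp {X : Type u} {X' : Type u} {Y : Type v} [DiffeologicalSpace X]
    [DiffeologicalSpace X'] [DiffeologicalSpace Y] (φ : X' → X) (hφ : DSmooth φ) :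
    HomotopyClasses X Y → HomotopyClasses X' Y :=
  Quot.map (fun f => ⟨fun x => f.1 (φ x), f.2.comp hφ⟩) (by
    rintro f g ⟨H, hH, h0, h1⟩
    exact ⟨fun z => H (φ z.1, z.2), hH.comp (smooth_pair (hφ.comp smooth_fst) smooth_snd),
      fun x => h0 (φ x), fun x => h1 (φ x)⟩)

end Homotopy

/-! ### The Milnor classifying space -/

section Milnor

/-- The subset of `[0,1]^ℕ × ∏ Xᵢ` of the `(tᵢ, xᵢ)` with only finitely many `tᵢ` non-zero and
`∑ tᵢ = 1`, with the subset diffeology of the product. -/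
abbrev PreJoin (X : ℕ → Type u) :=
  {z : (ℕ → Set.Icc (0 : ℝ) 1) × (∀ i, X i) //
    {i | (z.1 i : ℝ) ≠ 0}.Finite ∧ ∑ᶠ i, (z.1 i : ℝ) = 1}

/-- `(tᵢ, xᵢ) ∼ (tᵢ', xᵢ')` if `tᵢ = tᵢ'` for all `i`, and `xᵢ = xᵢ'` whenever `tᵢ ≠ 0`. -/
def joinSetoid (X : ℕ → Type u) : Setoid (PreJoin X) where
  r a b := (∀ i, a.1.1 i = b.1.1 i) ∧ ∀ i, (a.1.1 i : ℝ) ≠ 0 → a.1.2 i = b.1.2 i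
  iseqv :=
    { refl := fun _ => ⟨fun _ => rfl, fun _ _ => rfl⟩
      symm := fun h => ⟨fun i => (h.1 i).symm, fun i hi => (h.2 i (by rwa [h.1 i])).symm⟩
      trans := fun h k => ⟨fun i => (h.1 i).trans (k.1 i),
        fun i hi => (h.2 i hi).trans (k.2 i (by rwa [← h.1 i]))⟩ }

/-- The join of a sequence of diffeological spaces. -/
abbrev Join (X : ℕ → Type u) := Quotient (joinSetoid X)

variable (G : Type u) [Group G]

/-- The Milnor space `EG`, the join of countably many copies of `G`. -/
abbrev EG := Join fun _ : ℕ => G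

/-- The action `h • (tᵢ gᵢ) = (tᵢ gᵢ h⁻¹)` of `G` on `EG`. -/
instance actionEG : MulAction G (EG G) where
  smul h := Quotient.map
    (fun z => (⟨(z.1.1, fun i => z.1.2 i * h⁻¹), z.2⟩ : PreJoin fun _ : ℕ => G))
    fun _ _ k => ⟨k.1, fun i hi => congrArg (fun g => g * h⁻¹) (k.2 i hi)⟩
  one_smul := by
    rintro ⟨z⟩
    refine congrArg (Quotient.mk _) (Subtype.ext (Prod.ext rfl (funext fun i => ?_)))
    change z.1.2 i * 1⁻¹ = z.1.2 i
    rw [inv_one, mul_one]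
  mul_smul g h := by
    rintro ⟨z⟩
    refine congrArg (Quotient.mk _) (Subtype.ext (Prod.ext rfl (funext fun i => ?_)))
    change z.1.2 i * (g * h)⁻¹ = z.1.2 i * h⁻¹ * g⁻¹
    rw [mul_inv_rev, mul_assoc]

/-- The diffeological Milnor classifying space `BG = EG / G`, with the quotient diffeology. -/
abbrev BG := Quotient (MulAction.orbitRel G (EG G))

end Milnor

/-! ### The category of diffeological spaces and the two functors -/

open CategoryTheory

/-- A diffeological space, bundled. -/
structure Diffeol : Type (u + 1) where
  /-- The underlying set. -/
  carrier : Type u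
  [str : DiffeologicalSpace carrier]

attribute [instance] Diffeol.str

/-- The category of diffeological spaces and smooth maps. -/
instance : Category Diffeol.{u} where
  Hom X Y := {f : X.carrier → Y.carrier // DSmooth f}
  id X := ⟨fun x => x, dSmooth_id⟩
  comp f g := ⟨fun x => g.1 (f.1 x), g.2.comp f.2⟩

/-- A diffeological space is smoothly paracompact if its D-topology is paracompact and each
D-open cover `U` has a (locally finite) smooth partition of unity subordinate to it. -/
structure SmoothlyParacompact (X : Type u) [DiffeologicalSpace X] : Prop where
  paracompact : @ParacompactSpace X dTopology
  exists_partition : ∀ (ι : Type u) (U : ι → Set X), (∀ i, IsOpen[dTopology] (U i)) →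
    (⋃ i, U i = Set.univ) → ∃ ζ : ι → X → ℝ, IsSmoothPartitionOfUnity ζ ∧
      @LocallyFinite ι X dTopology (fun i => {x | ζ i x ≠ 0}) ∧ ∀ i, dSupport (ζ i) ⊆ U i

/-- The Hausdorff, second-countable, smoothly paracompact diffeological spaces. -/
def isHSP : ObjectProperty Diffeol.{u} := fun X =>
  @T2Space X.carrier dTopology ∧ @SecondCountableTopology X.carrier dTopology ∧
    SmoothlyParacompact X.carrier

/-- The full subcategory of Hausdorff, second-countable, smoothly paracompact spaces. -/
abbrev DiffeolHSP := isHSP.{u}.FullSubcategory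

variable (G : Type u) [Group G] [DiffeologicalSpace G]

/-- The contravariant functor `ℬ_G(·)`, acting on smooth maps by pullback of bundles. -/
def bundleFunctor : Diffeol.{u}ᵒᵖ ⥤ Type (u + 1) where
  obj X := BundleClasses G X.unop.carrier
  map f := ↾(BundleClasses.pullback f.unop.1 f.unop.2)
  map_id X := by
    ext ⟨P⟩
    exact Quotient.sound P.pullback_id
  map_comp f g := by
    ext ⟨P⟩
    exact Quotient.sound (P.pullback_comp f.unop.2 g.unop.2)

/-- The contravariant functor `[·, Y]`, acting on smooth maps by precomposition. -/
def homotopyFunctor (Y : Type u) [DiffeologicalSpace Y] : Diffeol.{u}ᵒᵖ ⥤ Type u where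
  obj X := HomotopyClasses X.unop.carrier Y
  map f := ↾(HomotopyClasses.precomp f.unop.1 f.unop.2)
  map_id X := by
    ext ⟨f⟩
    rfl
  map_comp f g := by
    ext ⟨h⟩
    rfl

end MilnorBG

end

open CategoryTheory

open Filter

/-! A principal bundle is handled through `PrincipalCore`: a smooth free action, local lifting of
plots, and smooth division (the `g` with `g • e = e'` depends smoothly on two plots in the same
fibres). For a diffeological group this is equivalent to `IsPrincipalBundle`, and `EG → BG`
satisfies it (`universalCore`). Everything is then said with equivariant smooth maps `Φ : E → EG`
covering `f : X → BG` (`Classifies`). Two bundles with the same `f` are isomorphic (`exists_iso`),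
since a point of a bundle is determined by its base point and its image in `EG`. The bijection sends
`f` to `f^*EG`, which carries a tautological `Φ`. Four facts are needed.

Numerability: `f^*EG` has a section wherever a given barycentric coordinate of `f` is non-zero.
Paracompactness refines these open sets to a locally finite cover with a subordinate partition of
unity.

Surjectivity: sections `s i` over a numerable cover and the partition functions `ζ i` give Milnor's
map, with weights `ζ i` and group coordinates the elements that carry `e` to `s i`.

Homotopy invariance: a homotopy `H` lifts to `EG` over `U × [0,1]` for small open `U`. Along the
partial sums of a countable partition of unity, a classifying map over `H (·, 0)` is transported
step by step to one over `H (·, 1)`; local finiteness makes the infinite process smooth.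

Injectivity: two classifying maps of one bundle are homotopic. If one occupies only odd places and
the other only even places, a segment joins them. To reach the odd places, the weights are first
made locally finite; then coordinate `i` slides to the place `2 * i + 1`, at a time of order `4 ^
(-i)`, so that every place is vacated before it is refilled. Local finiteness gives smoothness at
time zero, where the sliding times accumulate. -/

namespace MilnorBG

/-! ### Local smoothness -/

/-- The Euclidean space of dimension `n`. -/
abbrev Eucl (n : ℕ) := EuclideanSpace ℝ (Fin n)

section PlotAt

variable {X Y Z : Type*} [DiffeologicalSpace X] [DiffeologicalSpace Y] [DiffeologicalSpace Z]
  {n : ℕ}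

/-- The map `a` agrees with a plot near `x`. -/
def PlotAt (a : Eucl n → X) (x : Eucl n) : Prop := ∃ q : Eucl n → X, IsPlot q ∧ a =ᶠ[𝓝 x] q

theorem plotAt_of_isPlot {a : Eucl n → X} (h : IsPlot a) (x : Eucl n) : PlotAt a x :=
  ⟨a, h, EventuallyEq.rfl⟩

theorem PlotAt.congr {a b : Eucl n → X} {x : Eucl n} (h : PlotAt b x) (hab : a =ᶠ[𝓝 x] b) :
    PlotAt a x := by
  obtain ⟨q, hq, hbq⟩ := h
  exact ⟨q, hq, hab.trans hbq⟩

/-- The locality axiom tests reparametrizations with values in a neighbourhood, and on such a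
neighbourhood the map may be replaced by its local model. -/
theorem isPlot_of_plotAt {a : Eucl n → X} (h : ∀ x, PlotAt a x) : IsPlot a := by
  refine DiffeologicalSpace.locality fun x => ?_
  obtain ⟨q, hq, haq⟩ := h x
  obtain ⟨u, hu, hou, hxu⟩ := eventually_nhds_iff.1 haq
  refine ⟨u, hou, hxu, fun {m f} hfu hf => ?_⟩
  have : a ∘ f = q ∘ f := funext fun y => hu _ (hfu y)
  rw [this]
  exact isPlot_reparam hq hf

theorem PlotAt.comp {a : Eucl n → X} {x : Eucl n} (h : PlotAt a x) {f : X → Y} (hf : DSmooth f) :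
    PlotAt (fun y => f (a y)) x := by
  obtain ⟨q, hq, haq⟩ := h
  exact ⟨fun y => f (q y), hf n q hq, haq.fun_comp f⟩

theorem PlotAt.pair {a : Eucl n → X} {b : Eucl n → Y} {x : Eucl n} (ha : PlotAt a x)
    (hb : PlotAt b x) : PlotAt (fun y => (a y, b y)) x := by
  obtain ⟨q, hq, haq⟩ := ha
  obtain ⟨r, hr, hbr⟩ := hb
  exact ⟨fun y => (q y, r y), ⟨hq, hr⟩, haq.prodMk hbr⟩

/-- Plots have a full Euclidean space as domain, so a map on a subset cannot be composed directly.
`exists_smooth_localization` squeezes the plot into the subset without changing it near `x`. -/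
theorem PlotAt.of_subtype {P : X → Prop} {s : Subtype P → Y} (hs : DSmooth s) {p : Eucl n → X}
    (hp : IsPlot p) {a : Eucl n → Y} {x : Eucl n}
    (h : ∀ᶠ y in 𝓝 x, ∃ h : P (p y), a y = s ⟨p y, h⟩) : PlotAt a x := by
  obtain ⟨u, hu, hou, hxu⟩ := eventually_nhds_iff.1 h
  obtain ⟨f, hf, hfu, v, hv, hxv, hfv⟩ := exists_smooth_localization hou hxu
  have hq : IsPlot fun y => (⟨p (f y), (hu _ (hfu y)).1⟩ : Subtype P) :=
    isPlot_reparam (p := p) hp hf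
  refine ⟨fun y => s ⟨p (f y), (hu _ (hfu y)).1⟩, hs _ _ hq, ?_⟩
  filter_upwards [hv.mem_nhds hxv] with y hy
  obtain ⟨_, h2⟩ := hu _ (hfu y)
  simpa only [hfv y hy] using h2

theorem eventually_mem_of_isPlot {p : Eucl n → X} (hp : IsPlot p) {U : Set X}
    (hU : IsOpen[dTopology] U) {x : Eucl n} (hx : p x ∈ U) : ∀ᶠ y in 𝓝 x, p y ∈ U :=
  (isOpen_iff_preimages_plots.1 hU n p hp).mem_nhds hx

/-- The map `f` is smooth near each point of `S`. -/
def DSmoothOn (f : X → Y) (S : Set X) : Prop :=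
  ∀ (n : ℕ) (p : Eucl n → X), IsPlot p → ∀ x, p x ∈ S → PlotAt (fun y => f (p y)) x

theorem DSmoothOn.dSmooth {f : X → Y} (h : DSmoothOn f Set.univ) : DSmooth f :=
  fun n p hp => isPlot_of_plotAt fun x => h n p hp x trivial

theorem DSmoothOn.mono {f : X → Y} {S T : Set X} (h : DSmoothOn f S) (hT : T ⊆ S) :
    DSmoothOn f T := fun n p hp x hx => h n p hp x (hT hx)

theorem dSmoothOn_of_subtype {U : Set X} (hU : IsOpen[dTopology] U) {f : X → Y}
    (hf : DSmooth fun x : U => f x) : DSmoothOn f U := fun _ _ hp _ hx =>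
  PlotAt.of_subtype (P := fun z => z ∈ U) hf hp ((eventually_mem_of_isPlot hp hU hx).mono fun _ hy => ⟨hy, rfl⟩)

theorem isOpen_of_isPlot_real {f : X → ℝ} (hf : DSmooth f) {S : Set ℝ} (hS : IsOpen S) :
    IsOpen[dTopology] (f ⁻¹' S) :=
  @IsOpen.preimage X ℝ dTopology dTopology f hf.continuous S hS

theorem isOpen_ne_zero {f : X → ℝ} (hf : DSmooth f) : IsOpen[dTopology] {x | f x ≠ 0} :=
  isOpen_of_isPlot_real hf isOpen_ne

theorem eventually_eq_zero_of_notMem_dSupport {f : X → ℝ} {p : Eucl n → X} (hp : IsPlot p)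
    {x : Eucl n} (hx : p x ∉ dSupport f) : ∀ᶠ y in 𝓝 x, f (p y) = 0 := by
  let _ : TopologicalSpace X := dTopology
  have h1 : IsOpen (dSupport f)ᶜ := (isClosed_closure (s := {x | f x ≠ 0})).isOpen_compl
  filter_upwards [eventually_mem_of_isPlot hp h1 hx] with y hy
  by_contra h
  exact hy (subset_closure h)

theorem eventually_finite_of_locallyFinite {ι : Type*} {S : ι → Set X}
    (hS : @LocallyFinite ι X dTopology S) {p : Eucl n → X} (hp : IsPlot p) (x : Eucl n) :
    ∃ I : Set ι, I.Finite ∧ ∀ᶠ y in 𝓝 x, ∀ i, p y ∈ S i → i ∈ I := by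
  let _ : TopologicalSpace X := dTopology
  obtain ⟨t, ht, hfin⟩ := hS (p x)
  obtain ⟨o, hot, ho, hxo⟩ := mem_nhds_iff.1 ht
  refine ⟨_, hfin, ?_⟩
  filter_upwards [eventually_mem_of_isPlot hp ho hxo] with y hy i hi
  exact ⟨p y, hi, hot hy⟩

end PlotAt

/-! ### Real plots -/

section Real

variable {X : Type*} [DiffeologicalSpace X]

theorem smooth_add {f g : X → ℝ} (hf : DSmooth f) (hg : DSmooth g) :
    DSmooth fun x => f x + g x := fun n p hp =>
  ((hf n p hp).contDiff.add (hg n p hp).contDiff).isPlot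

theorem smooth_mul {f g : X → ℝ} (hf : DSmooth f) (hg : DSmooth g) :
    DSmooth fun x => f x * g x := fun n p hp =>
  ((hf n p hp).contDiff.mul (hg n p hp).contDiff).isPlot

theorem smooth_sub {f g : X → ℝ} (hf : DSmooth f) (hg : DSmooth g) :
    DSmooth fun x => f x - g x := fun n p hp =>
  ((hf n p hp).contDiff.sub (hg n p hp).contDiff).isPlot

theorem smooth_sum {ι : Type*} {f : ι → X → ℝ} (hf : ∀ i, DSmooth (f i)) (s : Finset ι) :
    DSmooth fun x => ∑ i ∈ s, f i x := fun n p hp =>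
  (ContDiff.sum fun i _ => (hf i n p hp).contDiff).isPlot

theorem smooth_contDiff_comp {f : X → ℝ} (hf : DSmooth f) {φ : ℝ → ℝ}
    (hφ : ContDiff ℝ (⊤ : ℕ∞) φ) : DSmooth fun x => φ (f x) := hφ.dSmooth.comp hf

end Real

/-! ### Principal bundles through local lifts and smooth division -/

/-- The element `g` with `g • e = e'`, if there is one. -/
noncomputable def quot (G : Type*) [Group G] {E : Type*} [MulAction G E] (e e' : E) : G :=
  open Classical in if h : ∃ g : G, g • e = e' then h.choose else 1

theorem quot_smul_of_exists {G : Type*} [Group G] {E : Type*} [MulAction G E] {e e' : E}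
    (h : ∃ g : G, g • e = e') : quot G e e' • e = e' := by
  rw [quot, dif_pos h]
  exact h.choose_spec

/-- A smooth free action of `G` with smooth division, and a quotient map along which plots lift
locally. -/
structure PrincipalCore (G : Type*) [Group G] [DiffeologicalSpace G] {X : Type*} {E : Type*}
    [DiffeologicalSpace X] [DiffeologicalSpace E] [MulAction G E] (π : E → X) : Prop where
  smooth : DSmooth π
  surjective : Function.Surjective π
  smooth_smul : DSmooth fun z : G × E => z.1 • z.2
  proj_smul : ∀ (g : G) (e : E), π (g • e) = π e
  free : ∀ (g h : G) (e : E), g • e = h • e → g = h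
  lift : ∀ (n : ℕ) (p : Eucl n → X), IsPlot p → ∀ x, ∃ q : Eucl n → E, IsPlot q ∧
    ∀ᶠ y in 𝓝 x, π (q y) = p y
  exists_div : ∀ (n : ℕ) (r r' : Eucl n → E), IsPlot r → IsPlot r' → (∀ y, π (r y) = π (r' y)) →
    ∃ a : Eucl n → G, IsPlot a ∧ ∀ y, a y • r y = r' y

section Core

variable {G : Type*} [Group G] [DiffeologicalSpace G] {X : Type*} {E : Type*}
  [DiffeologicalSpace X] [DiffeologicalSpace E] [MulAction G E] {π : E → X}

namespace PrincipalCore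

theorem quot_smul (hπ : PrincipalCore G π) {e e' : E} (h : π e = π e') :
    quot G e e' • e = e' := by
  -- Division of single points is division of constant plots of dimension zero.
  obtain ⟨a, -, ha⟩ := hπ.exists_div 0 (fun _ => e) (fun _ => e') isPlot_const isPlot_const
    fun _ => h
  exact quot_smul_of_exists ⟨a 0, ha 0⟩

theorem quot_eq (hπ : PrincipalCore G π) {e e' : E} {g : G} (h : g • e = e') :
    quot G e e' = g :=
  hπ.free _ _ e ((quot_smul_of_exists ⟨g, h⟩).trans h.symm)

theorem quot_smul_right (hπ : PrincipalCore G π) {e e' : E} (h : π e = π e') (g : G) :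
    quot G e (g • e') = g * quot G e e' :=
  hπ.quot_eq (by rw [mul_smul, hπ.quot_smul h])

theorem quot_smul_left (hπ : PrincipalCore G π) {e e' : E} (h : π e = π e') (g : G) :
    quot G (g • e) e' = quot G e e' * g⁻¹ :=
  hπ.quot_eq (by rw [mul_smul, inv_smul_smul, hπ.quot_smul h])

theorem isPlot_quot (hπ : PrincipalCore G π) {n : ℕ} {r r' : Eucl n → E} (hr : IsPlot r)
    (hr' : IsPlot r') (h : ∀ y, π (r y) = π (r' y)) : IsPlot fun y => quot G (r y) (r' y) := by
  obtain ⟨a, ha, hay⟩ := hπ.exists_div n r r' hr hr' h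
  have : (fun y => quot G (r y) (r' y)) = a := funext fun y => hπ.quot_eq (hay y)
  rwa [this]

/-- `exists_div` wants plots that share their fibres everywhere; localization reduces the local
hypothesis to that case. -/
theorem plotAt_quot (hπ : PrincipalCore G π) {n : ℕ} {r r' : Eucl n → E} {x : Eucl n}
    (hr : PlotAt r x) (hr' : PlotAt r' x) (h : ∀ᶠ y in 𝓝 x, π (r y) = π (r' y)) :
    PlotAt (fun y => quot G (r y) (r' y)) x := by
  obtain ⟨q, hq, hrq⟩ := hr
  obtain ⟨q', hq', hrq'⟩ := hr'
  have h2 : ∀ᶠ y in 𝓝 x, π (q y) = π (q' y) := by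
    filter_upwards [h, hrq, hrq'] with y h1 h2 h3
    rw [← h2, ← h3, h1]
  obtain ⟨u, hu, hou, hxu⟩ := eventually_nhds_iff.1 h2
  obtain ⟨f, hf, hfu, v, hv, hxv, hfv⟩ := exists_smooth_localization hou hxu
  refine ⟨_, hπ.isPlot_quot (isPlot_reparam hq hf) (isPlot_reparam hq' hf)
    fun y => hu _ (hfu y), ?_⟩
  filter_upwards [hv.mem_nhds hxv, hrq, hrq'] with y hy h1 h2
  simp only [Function.comp_apply, hfv y hy, h1, h2]

theorem plotAt_smul (hπ : PrincipalCore G π) {n : ℕ} {a : Eucl n → G} {r : Eucl n → E}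
    {x : Eucl n} (ha : PlotAt a x) (hr : PlotAt r x) : PlotAt (fun y => a y • r y) x :=
  (ha.pair hr).comp hπ.smooth_smul

/-- A smooth lift `q` of `f` to the total space trivializes the pullback along `f`. -/
noncomputable def trivialization (hπ : PrincipalCore G π) {Y : Type*} [DiffeologicalSpace Y]
    {f : Y → X} {q : Y → E} (hq : DSmooth q) (hqf : ∀ y, π (q y) = f y) :
    Diffeo (Y × G) (Pullback f π) where
  toFun z := ⟨(z.1, z.2 • q z.1), by rw [hπ.proj_smul, hqf]⟩
  invFun z := (z.1.1, quot G (q z.1.1) z.1.2)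
  left_inv z := Prod.ext rfl (hπ.quot_eq rfl)
  right_inv z := Subtype.ext (Prod.ext rfl (hπ.quot_smul ((hqf _).trans z.2)))
  smooth_toFun := smooth_subtype (smooth_pair smooth_fst
    (hπ.smooth_smul.comp (smooth_pair smooth_snd (hq.comp smooth_fst))))
  smooth_invFun := fun n p hp => ⟨hp.1, hπ.isPlot_quot (r := fun y => q (p y).1.1)
    (r' := fun y => (p y).1.2) (hq n _ hp.1) hp.2 fun y => (hqf _).trans (p y).2⟩

end PrincipalCore

/-- Freeness is injectivity of the local trivialization over a constant plot. For division, write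
both plots as `b • q` and `c • q` with the local section `q`; then `c * b⁻¹` carries the first to
the second. By freeness these local quotients agree with the global `quot`. -/
theorem IsPrincipalBundle.core [DiffeologicalGroup G] (h : IsPrincipalBundle G π) :
    PrincipalCore G π := by
  have hfree : ∀ (g k : G) (e : E), g • e = k • e → g = k := fun g k e hgk => by
    obtain ⟨V, -, haV, q, -, hqp, ψ, hψ⟩ :=
      h.equivariantlyTrivial 0 (fun _ => π e) isPlot_const 0
    let v : V := ⟨0, haV⟩
    obtain ⟨⟨v', l⟩, hl⟩ := ψ.toEquiv.surjective ⟨(v, e), (hqp v).symm ▸ hqp v⟩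
    have h1 := hψ v' l
    rw [hl] at h1
    obtain rfl : v = v' := congrArg Prod.fst h1
    have he : e = l • q v := congrArg Prod.snd h1
    have h2 : ψ.toEquiv (v, g * l) = ψ.toEquiv (v, k * l) := by
      apply Subtype.ext
      rw [hψ, hψ, mul_smul, mul_smul, ← he, hgk]
    exact mul_right_cancel (congrArg Prod.snd (ψ.toEquiv.injective h2))
  refine ⟨h.smooth, h.surjective, h.smooth_smul, h.proj_smul, hfree, fun n p hp x => ?_,
    fun n r r' hr hr' hrr => ?_⟩
  · obtain ⟨V, hV, haV, q, hq, hqp, -⟩ := h.equivariantlyTrivial n p hp x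
    have h1 : PlotAt (fun y => open Classical in if hy : y ∈ V then q ⟨y, hy⟩ else q ⟨x, haV⟩) x := by
      refine PlotAt.of_subtype (P := fun z => z ∈ V) hq (isPlot_id') ?_
      filter_upwards [hV.mem_nhds haV] with y hy
      exact ⟨hy, dif_pos hy⟩
    obtain ⟨q', hq', hqq⟩ := h1
    refine ⟨q', hq', ?_⟩
    filter_upwards [hV.mem_nhds haV, hqq] with y hy h2
    rw [← h2, dif_pos hy, hqp]
  · have key : ∀ x, ∃ V : Set (Eucl n), IsOpen V ∧ x ∈ V ∧ ∃ a : V → G, DSmooth a ∧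
        ∀ v : V, a v • r v = r' v := fun x => by
      obtain ⟨V, hV, haV, q, hq, hqp, ψ, hψ⟩ :=
        h.equivariantlyTrivial n (fun y => π (r y)) (h.smooth n r hr) x
      have hs : ∀ (s : Eucl n → E), IsPlot s → (∀ y, π (s y) = π (r y)) → ∃ b : V → G, DSmooth b ∧
          ∀ v : V, b v • q v = s v := fun s hs hsr => by
        let σ : V → Pullback (fun v : V => π (r v)) π := fun v => ⟨(v, s v), (hsr v).symm⟩
        have hσ : DSmooth σ :=
          smooth_subtype (smooth_pair dSmooth_id (hs.dSmooth.comp smooth_val))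
        refine ⟨fun v => (ψ.toEquiv.symm (σ v)).2, smooth_snd.comp (ψ.smooth_invFun.comp hσ),
          fun v => ?_⟩
        obtain ⟨⟨v', l⟩, hl⟩ := ψ.toEquiv.surjective (σ v)
        have h1 := hψ v' l
        rw [hl] at h1
        obtain rfl : v = v' := congrArg Prod.fst h1
        change (ψ.toEquiv.symm (σ v)).2 • q v = s v
        rw [← hl, Equiv.symm_apply_apply]
        exact (congrArg Prod.snd h1).symm
      obtain ⟨b, hb, hbr⟩ := hs r hr fun _ => rfl
      obtain ⟨c, hc, hcr⟩ := hs r' hr' fun y => (hrr y).symm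
      refine ⟨V, hV, haV, fun v => c v * (b v)⁻¹,
        DiffeologicalGroup.smooth_mul.comp (smooth_pair hc (DiffeologicalGroup.smooth_inv.comp hb)),
        fun v => ?_⟩
      rw [← hbr, ← hcr, mul_smul, inv_smul_smul]
    refine ⟨fun y => quot G (r y) (r' y), isPlot_of_plotAt fun x => ?_, fun y => ?_⟩
    · obtain ⟨V, hV, haV, a, ha, har⟩ := key x
      refine PlotAt.of_subtype (P := fun z => z ∈ V) ha (isPlot_id') ?_
      filter_upwards [hV.mem_nhds haV] with y hy
      exact ⟨hy, hfree _ _ (r y) ((quot_smul_of_exists ⟨_, har ⟨y, hy⟩⟩).trans (har ⟨y, hy⟩).symm)⟩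
    · obtain ⟨V, hV, haV, a, ha, har⟩ := key y
      exact quot_smul_of_exists ⟨_, har ⟨y, haV⟩⟩

end Core

/-! ### From the core back to principal bundles, and pullback of the core -/

section ToBundle

variable {G : Type u} [Group G] [DiffeologicalSpace G] {X : Type v} {E : Type u}
  [DiffeologicalSpace X] [DiffeologicalSpace E] [MulAction G E] {π : E → X}

theorem PrincipalCore.exists_section (hπ : PrincipalCore G π) {n : ℕ} {p : Eucl n → X}
    (hp : IsPlot p) (x : Eucl n) : ∃ V : Set (Eucl n), IsOpen V ∧ x ∈ V ∧ ∃ q : V → E,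
      DSmooth q ∧ ∀ v : V, π (q v) = p v := by
  obtain ⟨q, hq, hqp⟩ := hπ.lift n p hp x
  obtain ⟨V, hVq, hV, hxV⟩ := eventually_nhds_iff.1 hqp
  exact ⟨V, hV, hxV, fun v => q v, hq.dSmooth.comp smooth_val, fun v => hVq v v.2⟩

theorem PrincipalCore.isTrivialOver (hπ : PrincipalCore G π) {U : Set X} {q : U → E}
    (hq : DSmooth q) (hqp : ∀ v : U, π (q v) = v) : IsTrivialOver π U G :=
  ⟨(hπ.trivialization (f := (Subtype.val : U → X)) hq hqp).symm, fun _ => rfl⟩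

/-- A local lift of a plot trivializes the pullback equivariantly, the inverse being given by smooth
division. -/
theorem PrincipalCore.isPrincipalBundle (hπ : PrincipalCore G π) : IsPrincipalBundle G π where
  smooth := hπ.smooth
  surjective := hπ.surjective
  locallyTrivial n p hp := by
    refine ⟨G, inferInstance, fun x => ?_⟩
    obtain ⟨V, hV, hxV, q, hq, hqp⟩ := hπ.exists_section hp x
    refine ⟨V, hV, hxV, ?_⟩
    have h1 : IsTrivial (Pullback.proj (fun v : V => p v) π) G :=
      ⟨(hπ.trivialization hq hqp).symm, fun _ => rfl⟩
    exact h1.congr (pullbackComp Subtype.val smooth_val p π) fun _ => rfl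
  smooth_smul := hπ.smooth_smul
  proj_smul := hπ.proj_smul
  equivariantlyTrivial n p hp x := by
    obtain ⟨V, hV, hxV, q, hq, hqp⟩ := hπ.exists_section hp x
    exact ⟨V, hV, hxV, q, hq, hqp, hπ.trivialization hq hqp, fun _ _ => rfl⟩

/-- The action on a pullback. -/
abbrev pullbackMulAction (hπ : ∀ (g : G) (e : E), π (g • e) = π e) {Y : Type*} (f : Y → X) :
    MulAction G (Pullback f π) where
  smul g z := ⟨(z.1.1, g • z.1.2), z.2.trans (hπ g _).symm⟩
  one_smul z := Subtype.ext (Prod.ext rfl (one_smul G z.1.2))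
  mul_smul g h z := Subtype.ext (Prod.ext rfl (mul_smul g h z.1.2))

theorem PrincipalCore.pullback (hπ : PrincipalCore G π) {Y : Type*} [DiffeologicalSpace Y]
    {f : Y → X} (hf : DSmooth f) :
    @PrincipalCore G _ _ Y (Pullback f π) _ _ (pullbackMulAction hπ.proj_smul f)
      (Pullback.proj f π) := by
  let _ := pullbackMulAction hπ.proj_smul f
  refine ⟨smooth_fst.comp smooth_val, fun y => ?_, ?_, fun _ _ => rfl, fun g h e he => ?_,
    fun n p hp x => ?_, fun n r r' hr hr' hrr => ?_⟩
  · obtain ⟨e, he⟩ := hπ.surjective (f y)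
    exact ⟨⟨(y, e), he.symm⟩, rfl⟩
  · exact smooth_subtype (smooth_pair (smooth_fst.comp (smooth_val.comp smooth_snd))
      (hπ.smooth_smul.comp (smooth_pair smooth_fst (smooth_snd.comp (smooth_val.comp smooth_snd)))))
  · exact hπ.free g h e.1.2 (congrArg (fun z => z.1.2) he)
  · obtain ⟨q, hq, hqp⟩ := hπ.lift n (fun y => f (p y)) (hf n p hp) x
    obtain ⟨V, hVq, hV, hxV⟩ := eventually_nhds_iff.1 hqp
    obtain ⟨φ, hφ, hφu, v, hv, hxv, hφv⟩ := exists_smooth_localization hV hxV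
    refine ⟨fun y => ⟨(p (φ y), q (φ y)), (hVq _ (hφu y)).symm⟩,
      ⟨isPlot_reparam hp hφ, isPlot_reparam hq hφ⟩, ?_⟩
    filter_upwards [hv.mem_nhds hxv] with y hy
    exact congrArg p (hφv y hy)
  · refine ⟨fun y => quot G (r y).1.2 (r' y).1.2, hπ.isPlot_quot hr.2 hr'.2 fun y => ?_,
      fun y => Subtype.ext (Prod.ext (hrr y) (hπ.quot_smul ?_))⟩
    all_goals rw [← (r y).2, ← (r' y).2]; exact congrArg f (hrr y)

end ToBundle

/-! ### Coordinates on the Milnor space -/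

/-- Barycentric coordinates: non-negative, finitely many non-zero, of sum one. -/
structure IsWeight (T : ℕ → ℝ) : Prop where
  nonneg : ∀ i, 0 ≤ T i
  finite : {i | T i ≠ 0}.Finite
  sum : ∑ᶠ i, T i = 1

theorem IsWeight.le_one {T : ℕ → ℝ} (h : IsWeight T) (i : ℕ) : T i ≤ 1 :=
  h.sum ▸ single_le_finsum i h.finite h.nonneg

theorem IsWeight.exists_ne_zero {T : ℕ → ℝ} (h : IsWeight T) : ∃ i, T i ≠ 0 := by
  by_contra! h0
  have := h.sum
  simp [h0] at this

theorem IsWeight.add {A B : ℕ → ℝ} (hA : ∀ i, 0 ≤ A i) (hB : ∀ i, 0 ≤ B i)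
    (hA' : {i | A i ≠ 0}.Finite) (hB' : {i | B i ≠ 0}.Finite)
    (h : ∑ᶠ i, A i + ∑ᶠ i, B i = 1) : IsWeight fun i => A i + B i where
  nonneg i := add_nonneg (hA i) (hB i)
  finite := (hA'.union hB').subset fun i hi => by
    by_contra h0
    simp only [Set.mem_union, Set.mem_ofPred_eq, not_or, not_not] at h0
    exact hi (by rw [h0.1, h0.2, add_zero])
  sum := by rw [finsum_add_distrib hA' hB', h]

theorem IsWeight.convex {T T' : ℕ → ℝ} (h : IsWeight T) (h' : IsWeight T') {a : ℝ} (h0 : 0 ≤ a)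
    (h1 : a ≤ 1) : IsWeight fun i => (1 - a) * T i + a * T' i := by
  refine IsWeight.add (fun i => mul_nonneg (by linarith) (h.nonneg i))
    (fun i => mul_nonneg h0 (h'.nonneg i)) (h.finite.subset fun i hi => right_ne_zero_of_mul hi)
    (h'.finite.subset fun i hi => right_ne_zero_of_mul hi) ?_
  rw [← mul_finsum' _ _ h.finite, ← mul_finsum' _ _ h'.finite, h.sum, h'.sum]
  ring

section Coordinates

variable {G : Type u}

/-- The point of the join with given coordinates. -/
noncomputable def joinMk (T : ℕ → ℝ) (hT : IsWeight T) (g : ℕ → G) : EG G :=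
  Quotient.mk (joinSetoid fun _ : ℕ => G)
    ⟨(fun i => ⟨T i, hT.nonneg i, hT.le_one i⟩, g), hT.finite, hT.sum⟩

/-- The barycentric coordinates of a point of `EG`. -/
def weight (e : EG G) (i : ℕ) : ℝ :=
  Quotient.lift (fun z : PreJoin fun _ : ℕ => G => (z.1.1 i : ℝ))
    (fun _ _ h => congrArg Subtype.val ((show (joinSetoid fun _ : ℕ => G).r _ _ from h).1 i)) e

/-- The group coordinates of a point of `EG`, meaningful where the weight does not vanish. -/
noncomputable def coord (e : EG G) (i : ℕ) : G := (Quotient.out e).1.2 i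

theorem isWeight_weight (e : EG G) : IsWeight (weight e) := by
  obtain ⟨z, rfl⟩ := Quotient.exists_rep e
  exact ⟨fun i => (z.1.1 i).2.1, z.2.1, z.2.2⟩

theorem coord_mk (z : PreJoin fun _ : ℕ => G) (i : ℕ) (h : (z.1.1 i : ℝ) ≠ 0) :
    coord (Quotient.mk (joinSetoid fun _ : ℕ => G) z) i = z.1.2 i := by
  have h1 : (joinSetoid fun _ : ℕ => G).r (Quotient.out (Quotient.mk _ z)) z :=
    Quotient.mk_out (s := joinSetoid fun _ : ℕ => G) z
  exact h1.2 i (by rwa [h1.1 i])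

@[simp]
theorem weight_joinMk {T : ℕ → ℝ} (hT : IsWeight T) (g : ℕ → G) (i : ℕ) :
    weight (joinMk T hT g) i = T i := rfl

theorem coord_joinMk {T : ℕ → ℝ} (hT : IsWeight T) (g : ℕ → G) {i : ℕ} (h : T i ≠ 0) :
    coord (joinMk T hT g) i = g i := coord_mk _ i h

theorem EG_ext {e e' : EG G} (h : ∀ i, weight e i = weight e' i)
    (h' : ∀ i, weight e i ≠ 0 → coord e i = coord e' i) : e = e' := by
  obtain ⟨z, rfl⟩ := Quotient.exists_rep e
  obtain ⟨z', rfl⟩ := Quotient.exists_rep e'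
  refine Quotient.sound ⟨fun i => Subtype.ext (h i), fun i hi => ?_⟩
  have := h' i hi
  rwa [coord_mk _ _ hi, coord_mk _ _ (by rw [← show _ = (z'.1.1 i : ℝ) from h i]; exact hi)] at this

/-! ### The action on the Milnor space, and its orbits -/

section Action

variable [Group G]

@[simp]
theorem weight_smul (g : G) (e : EG G) (i : ℕ) : weight (g • e) i = weight e i := by
  obtain ⟨z, rfl⟩ := Quotient.exists_rep e
  rfl

theorem coord_smul (g : G) (e : EG G) {i : ℕ} (h : weight e i ≠ 0) :
    coord (g • e) i = coord e i * g⁻¹ := by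
  obtain ⟨z, rfl⟩ := Quotient.exists_rep e
  exact (coord_mk (⟨(z.1.1, fun i => z.1.2 i * g⁻¹), z.2⟩ : PreJoin fun _ : ℕ => G) i h).trans
    (by rw [coord_mk _ _ h])

/-- The projection of the universal bundle. -/
def universalProj : EG G → BG G := Quotient.mk (MulAction.orbitRel G (EG G))

theorem universalProj_smul (g : G) (e : EG G) : universalProj (g • e) = universalProj e :=
  Quotient.sound ⟨g, rfl⟩

theorem exists_smul_eq {e e' : EG G} (h : universalProj e = universalProj e') :
    ∃ g : G, g • e = e' := (Quotient.exact h.symm :)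

theorem smul_free_EG {g h : G} {e : EG G} (he : g • e = h • e) : g = h := by
  obtain ⟨i, hi⟩ := (isWeight_weight e).exists_ne_zero
  have h1 := congrArg (fun e => coord e i) he
  simp only [coord_smul _ _ hi] at h1
  exact inv_injective (mul_left_cancel h1)

/-- The barycentric coordinates of a point of `BG`. -/
def baseWeight (b : BG G) (i : ℕ) : ℝ :=
  Quotient.lift (fun e : EG G => weight e i)
    (by rintro _ e ⟨g, rfl⟩; exact weight_smul g e i) b

@[simp]
theorem baseWeight_proj (e : EG G) (i : ℕ) : baseWeight (universalProj e) i = weight e i := rfl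

theorem isWeight_baseWeight (b : BG G) : IsWeight (baseWeight b) := by
  obtain ⟨e, rfl⟩ := Quotient.exists_rep b
  exact isWeight_weight e

/-- The section of the universal bundle over the set where the `i`-th weight does not vanish. -/
noncomputable def universalSection (i : ℕ) (b : BG G) : EG G :=
  coord (Quotient.out b) i • Quotient.out b

theorem universalProj_section (i : ℕ) (b : BG G) :
    universalProj (universalSection i b) = b :=
  (universalProj_smul _ _).trans (Quotient.out_eq b)

/-- The `i`-th group coordinate of `coord e i • e` is `1`, which singles out one point in each
orbit. So the choice of representative in `universalSection` is immaterial, and the section is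
smooth where the weight does not vanish. -/
theorem universalSection_proj {i : ℕ} {e : EG G} (h : weight e i ≠ 0) :
    universalSection i (universalProj e) = coord e i • e := by
  obtain ⟨g, hg⟩ := exists_smul_eq (Quotient.out_eq (universalProj e) :
    universalProj (Quotient.out (universalProj e)) = universalProj e).symm
  rw [universalSection, ← hg, coord_smul _ _ h, ← mul_smul, inv_mul_cancel_right]

end Action

variable [DiffeologicalSpace G]

theorem smooth_weight (i : ℕ) : DSmooth fun e : EG G => weight e i := fun n p hp =>
  isPlot_of_plotAt fun x => by
    obtain ⟨v, hv, hxv, q, hq, hqv⟩ := hp x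
    refine ⟨fun y => ((q y).1.1 i : ℝ), hq.1 i, ?_⟩
    filter_upwards [hv.mem_nhds hxv] with y hy
    rw [Function.comp_apply, hqv y hy]
    rfl

/-- Near each point, the group coordinates of a plot of `EG` are represented by plots. -/
theorem exists_coord_plot {n : ℕ} {p : Eucl n → EG G} {x : Eucl n} (hp : PlotAt p x) :
    ∃ γ : ℕ → Eucl n → G, (∀ i, IsPlot (γ i)) ∧
      ∀ᶠ y in 𝓝 x, ∀ i, weight (p y) i ≠ 0 → coord (p y) i = γ i y := by
  obtain ⟨p', hp', hpp⟩ := hp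
  obtain ⟨v, hv, hxv, q, hq, hqv⟩ := hp' x
  refine ⟨fun i y => (q y).1.2 i, hq.2, ?_⟩
  filter_upwards [hv.mem_nhds hxv, hpp] with y hy hpy i hi
  rw [hpy, hqv y hy] at hi ⊢
  exact coord_mk _ _ hi

/-- The coordinates `γ` define a plot before passing to the quotient, and it represents `p` near `x`
because coordinates of weight zero are forgotten. One neighbourhood must serve all `i` at once, as
there are infinitely many coordinates. -/
theorem plotAt_EG {n : ℕ} {p : Eucl n → EG G} {x : Eucl n}
    (hw : ∀ i, IsPlot fun y => weight (p y) i) (γ : ℕ → Eucl n → G) (hγ : ∀ i, IsPlot (γ i))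
    (h : ∀ᶠ y in 𝓝 x, ∀ i, weight (p y) i ≠ 0 → coord (p y) i = γ i y) : PlotAt p x := by
  refine ⟨fun y => joinMk (weight (p y)) (isWeight_weight _) fun i => γ i y, fun z =>
    ⟨Set.univ, isOpen_univ, trivial, fun y => ⟨(fun i => ⟨weight (p y) i,
      (isWeight_weight _).nonneg i, (isWeight_weight _).le_one i⟩, fun i => γ i y),
      (isWeight_weight _).finite, (isWeight_weight _).sum⟩, ⟨hw, hγ⟩, fun _ _ => rfl⟩, ?_⟩
  filter_upwards [h] with y hy
  refine EG_ext (fun i => rfl) fun i hi => ?_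
  rw [coord_joinMk _ _ hi, hy i hi]

theorem plotAt_coord {n : ℕ} {p : Eucl n → EG G} {x : Eucl n} (hp : PlotAt p x) {i : ℕ}
    (hi : weight (p x) i ≠ 0) : PlotAt (fun y => coord (p y) i) x := by
  obtain ⟨γ, hγ, h⟩ := exists_coord_plot hp
  refine ⟨γ i, hγ i, ?_⟩
  obtain ⟨q, hq, hpq⟩ := hp
  have hx : q x ∈ {e : EG G | weight e i ≠ 0} := by rw [← hpq.eq_of_nhds]; exact hi
  filter_upwards [h, hpq, eventually_mem_of_isPlot hq (isOpen_ne_zero (smooth_weight i)) hx]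
    with y hy h1 h2
  exact hy i (by rw [h1]; exact h2)

/-- A map to `EG` given by weights and group coordinates is smooth if the weights are smooth and
near each point the group coordinates agree with plots where the weights do not vanish. -/
theorem dSmooth_joinMk {Y : Type*} [DiffeologicalSpace Y] {T : Y → ℕ → ℝ}
    (hT : ∀ y, IsWeight (T y)) (g : Y → ℕ → G) (hTs : ∀ i, DSmooth fun y => T y i)
    (h : ∀ (n : ℕ) (p : Eucl n → Y), IsPlot p → ∀ x, ∃ γ : ℕ → Eucl n → G, (∀ i, IsPlot (γ i)) ∧
      ∀ᶠ y in 𝓝 x, ∀ i, T (p y) i ≠ 0 → g (p y) i = γ i y) :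
    DSmooth fun y => joinMk (T y) (hT y) (g y) := fun n p hp => isPlot_of_plotAt fun x => by
  obtain ⟨γ, hγ, hγg⟩ := h n p hp x
  refine plotAt_EG (fun i => hTs i n p hp) γ hγ ?_
  filter_upwards [hγg] with y hy i hi
  rw [← hy i hi]
  exact coord_joinMk (hT (p y)) _ hi

variable [Group G]

theorem smooth_universalProj : DSmooth (universalProj : EG G → BG G) := fun _ p hp _ =>
  ⟨Set.univ, isOpen_univ, trivial, p, hp, fun _ _ => rfl⟩

variable [DiffeologicalGroup G]

theorem smooth_smul_EG : DSmooth fun z : G × EG G => z.1 • z.2 := fun n p hp =>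
  isPlot_of_plotAt fun x => by
    obtain ⟨γ, hγ, h⟩ := exists_coord_plot (plotAt_of_isPlot hp.2 x)
    refine plotAt_EG (fun i => ?_) (fun i y => γ i y * (p y).1⁻¹) (fun i => ?_) ?_
    · simp only [Function.comp_apply, weight_smul]
      exact smooth_weight i n _ hp.2
    · exact DiffeologicalGroup.smooth_mul n (fun y => (γ i y, (p y).1⁻¹))
        ⟨hγ i, DiffeologicalGroup.smooth_inv n _ hp.1⟩
    · filter_upwards [h] with y hy i hi
      simp only [Function.comp_apply, weight_smul] at hi ⊢
      rw [coord_smul _ _ hi, hy i hi]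

/-- The universal bundle `EG → BG`. -/
theorem universalCore : PrincipalCore G (universalProj : EG G → BG G) where
  smooth := smooth_universalProj
  surjective := Quotient.mk_surjective
  smooth_smul := smooth_smul_EG
  proj_smul := universalProj_smul
  free _ _ _ := smul_free_EG
  lift n p hp x := by
    obtain ⟨v, hv, hxv, q, hq, hqv⟩ := hp x
    refine ⟨q, hq, ?_⟩
    filter_upwards [hv.mem_nhds hxv] with y hy
    exact (hqv y hy).symm
  exists_div n r r' hr hr' hrr := by
    choose a ha using fun y => exists_smul_eq (hrr y)
    refine ⟨a, isPlot_of_plotAt fun x => ?_, ha⟩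
    -- Where the `i`-th weight is non-zero, `coord (r' y) i = coord (r y) i * (a y)⁻¹` can be solved
    -- for `a y` by smooth operations.
    obtain ⟨i, hi⟩ := (isWeight_weight (r x)).exists_ne_zero
    have hw : ∀ y, weight (r' y) i = weight (r y) i := fun y => by rw [← ha, weight_smul]
    have h1 := plotAt_coord (plotAt_of_isPlot hr x) hi
    have h2 := plotAt_coord (plotAt_of_isPlot hr' x) (i := i) (by rwa [hw])
    refine (((h2.comp DiffeologicalGroup.smooth_inv).pair h1).comp
      DiffeologicalGroup.smooth_mul).congr ?_
    filter_upwards [eventually_mem_of_isPlot hr (isOpen_ne_zero (smooth_weight i)) hi] with y hy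
    have h3 : coord (r' y) i = coord (r y) i * (a y)⁻¹ := by rw [← ha, coord_smul _ _ hy]
    simp only [h3, mul_inv_rev, inv_inv, inv_mul_cancel_right]

theorem smooth_baseWeight (i : ℕ) : DSmooth fun b : BG G => baseWeight b i := fun n p hp =>
  isPlot_of_plotAt fun x => by
    obtain ⟨q, hq, hqp⟩ := universalCore.lift n p hp x
    refine ⟨fun y => weight (q y) i, smooth_weight i n q hq, ?_⟩
    filter_upwards [hqp] with y hy
    rw [Function.comp_apply, ← hy, baseWeight_proj]

theorem smoothOn_universalSection (i : ℕ) :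
    DSmoothOn (universalSection i : BG G → EG G) {b | baseWeight b i ≠ 0} := fun n p hp x hx => by
  obtain ⟨q, hq, hqp⟩ := universalCore.lift n p hp x
  have hqx : weight (q x) i ≠ 0 := by
    have : p x ∈ {b : BG G | baseWeight b i ≠ 0} := hx
    rwa [← hqp.self_of_nhds] at this
  refine (universalCore.plotAt_smul (plotAt_coord (plotAt_of_isPlot hq x) hqx)
    (plotAt_of_isPlot hq x)).congr ?_
  filter_upwards [hqp, eventually_mem_of_isPlot hq (isOpen_ne_zero (smooth_weight i)) hqx]
    with y hy h2
  rw [← hy, universalSection_proj h2]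

end Coordinates

/-! ### Equivariant maps to the Milnor space -/

section Classifying

variable {G : Type u} [Group G] [DiffeologicalSpace G] {X : Type*} {E E' : Type*}
  [DiffeologicalSpace X] [DiffeologicalSpace E] [DiffeologicalSpace E'] [MulAction G E]
  [MulAction G E'] {π : E → X} {π' : E' → X}

/-- A smooth equivariant map to `EG` covering the map `f` to `BG`. -/
structure Classifies {X : Type*} (π : E → X) (Φ : E → EG G) (f : X → BG G) : Prop where
  smooth : DSmooth Φ
  map_smul : ∀ (g : G) (e : E), Φ (g • e) = g • Φ e
  proj : ∀ e, universalProj (Φ e) = f (π e)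

theorem Classifies.comp {X Y : Type*} {π : E → X} {Φ : E → EG G} {f : X → BG G} (h : Classifies π Φ f)
    {F : E' → E} (hF : DSmooth F) (hFG : ∀ (g : G) (e : E'), F (g • e) = g • F e)
    {ρ : E' → Y} {k : Y → X} (hFk : ∀ e, π (F e) = k (ρ e)) :
    Classifies ρ (fun e => Φ (F e)) (fun y => f (k y)) :=
  ⟨h.smooth.comp hF, fun g e => by rw [hFG, h.map_smul], fun e => by rw [h.proj, hFk]⟩

theorem PrincipalCore.smooth_of_comp_proj (hπ : PrincipalCore G π) {Y : Type*}
    [DiffeologicalSpace Y] {f : X → Y} (hf : DSmooth fun e => f (π e)) : DSmooth f :=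
  fun n p hp => isPlot_of_plotAt fun x => by
    obtain ⟨q, hq, hqp⟩ := hπ.lift n p hp x
    exact ⟨_, hf n q hq, hqp.mono fun y hy => congrArg f hy.symm⟩

/-- By equivariance the orbit of `Φ e` depends on `π e` only; the induced map is smooth because
plots of `X` lift locally to `E`. -/
theorem PrincipalCore.exists_classifies (hπ : PrincipalCore G π) {Φ : E → EG G} (hΦ : DSmooth Φ)
    (hΦG : ∀ (g : G) (e : E), Φ (g • e) = g • Φ e) : ∃ f : X → BG G, DSmooth f ∧
      Classifies π Φ f := by
  let f : X → BG G := fun x => universalProj (Φ (Function.surjInv hπ.surjective x))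
  have hf : ∀ e, universalProj (Φ e) = f (π e) := fun e => by
    have h1 : π (Function.surjInv hπ.surjective (π e)) = π e :=
      Function.surjInv_eq hπ.surjective (π e)
    change _ = universalProj (Φ (Function.surjInv hπ.surjective (π e)))
    conv_lhs => rw [← hπ.quot_smul h1, hΦG, universalProj_smul]
  refine ⟨f, hπ.smooth_of_comp_proj ?_, hΦ, hΦG, hf⟩
  simpa only [← hf] using smooth_universalProj.comp' hΦ

/-- An equivariant homotopy descends to orbits, and it is enough to build homotopies upstairs. -/
theorem PrincipalCore.homotopic (hπ : PrincipalCore G π) {Φ₀ Φ₁ : E → EG G}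
    {f₀ f₁ : {f : X → BG G // DSmooth f}} (h₀ : Classifies π Φ₀ f₀.1) (h₁ : Classifies π Φ₁ f₁.1)
    {Ψ : E × ℝ → EG G} (hΨ : DSmooth Ψ) (hΨG : ∀ (g : G) (e : E) (τ : ℝ),
      Ψ (g • e, τ) = g • Ψ (e, τ)) (hΨ₀ : ∀ e, Ψ (e, 0) = Φ₀ e) (hΨ₁ : ∀ e, Ψ (e, 1) = Φ₁ e) :
    SmoothHomotopic f₀ f₁ := by
  have hs : ∀ x, π (Function.surjInv hπ.surjective x) = x :=
    fun x => Function.surjInv_eq hπ.surjective x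
  have key : ∀ e τ, universalProj (Ψ (Function.surjInv hπ.surjective (π e), τ)) =
      universalProj (Ψ (e, τ)) := fun e τ => by
    conv_rhs => rw [← hπ.quot_smul (hs (π e)), hΨG, universalProj_smul]
  refine ⟨fun z => universalProj (Ψ (Function.surjInv hπ.surjective z.1, z.2)), ?_,
    fun x => ?_, fun x => ?_⟩
  · intro n p hp
    refine isPlot_of_plotAt fun x => ?_
    obtain ⟨q, hq, hqp⟩ := hπ.lift n _ hp.1 x
    refine ⟨fun y => universalProj (Ψ (q y, (p y).2)),
      smooth_universalProj n _ (hΨ n (fun y => (q y, (p y).2)) ⟨hq, hp.2⟩), ?_⟩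
    filter_upwards [hqp] with y hy
    rw [← key, hy]
    rfl
  · change universalProj (Ψ (_, 0)) = _
    rw [hΨ₀, h₀.proj, hs]
  · change universalProj (Ψ (_, 1)) = _
    rw [hΨ₁, h₁.proj, hs]

/-- If `e' = g • e` and `Φ e' = Φ e`, then `g` fixes `Φ e`, and the action on `EG` is free. Hence a
point is determined by its images in `X` and `EG`. -/
theorem Classifies.injective (hπ : PrincipalCore G π) {Φ : E → EG G} {f : X → BG G}
    (h : Classifies π Φ f) {e e' : E} (h1 : π e = π e') (h2 : Φ e = Φ e') : e = e' := by
  have h3 := hπ.quot_smul h1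
  have h4 : quot G e e' = 1 := by
    refine smul_free_EG (e := Φ e) ?_
    rw [← h.map_smul, h3, one_smul, h2]
  rwa [h4, one_smul] at h3

/-- The map over `X` between principal bundles with the same classifying map. -/
theorem PrincipalCore.exists_map (hπ : PrincipalCore G π) (hπ' : PrincipalCore G π')
    [DiffeologicalGroup G] {Φ : E → EG G} {Φ' : E' → EG G} {f : X → BG G}
    (h : Classifies π Φ f) (h' : Classifies π' Φ' f) :
    ∃ F : E → E', DSmooth F ∧ ∀ e, π' (F e) = π e ∧ Φ' (F e) = Φ e := by
  let s : E → E' := fun e => Function.surjInv hπ'.surjective (π e)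
  have hs : ∀ e, π' (s e) = π e := fun e => Function.surjInv_eq hπ'.surjective (π e)
  have hF : ∀ (e : E) (e' : E'), π' e' = π e → π' (quot G (Φ' e') (Φ e) • e') = π e ∧
      Φ' (quot G (Φ' e') (Φ e) • e') = Φ e := fun e e' hee => by
    refine ⟨by rw [hπ'.proj_smul, hee], ?_⟩
    rw [h'.map_smul, universalCore.quot_smul (by rw [h.proj, h'.proj, hee])]
  -- The set-theoretic choice `s` need not be smooth. The value does not depend on it, so near a
  -- given point a smooth local lift `q` replaces it.
  refine ⟨fun e => quot G (Φ' (s e)) (Φ e) • s e, fun n p hp => isPlot_of_plotAt fun x => ?_,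
    fun e => hF e (s e) (hs e)⟩
  obtain ⟨q, hq, hqp⟩ := hπ'.lift n _ (hπ.smooth n p hp) x
  refine (hπ'.plotAt_smul (universalCore.plotAt_quot (plotAt_of_isPlot (h'.smooth n q hq) x)
    (plotAt_of_isPlot (h.smooth n p hp) x) ?_) (plotAt_of_isPlot hq x)).congr ?_
  · filter_upwards [hqp] with y hy
    simp only [Function.comp_apply, h.proj, h'.proj] at hy ⊢
    rw [hy]
  · filter_upwards [hqp] with y hy
    have h3 := hF (p y) (s (p y)) (hs _)
    have h4 := hF (p y) (q y) hy
    exact h'.injective hπ' (h3.1.trans h4.1.symm) (h3.2.trans h4.2.symm)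

/-- Principal bundles with the same classifying map are isomorphic. -/
theorem PrincipalCore.exists_iso (hπ : PrincipalCore G π) (hπ' : PrincipalCore G π')
    [DiffeologicalGroup G] {Φ : E → EG G} {Φ' : E' → EG G} {f : X → BG G}
    (h : Classifies π Φ f) (h' : Classifies π' Φ' f) :
    ∃ F : Diffeo E E', (∀ e, π' (F.toEquiv e) = π e) ∧
      ∀ (g : G) (e : E), F.toEquiv (g • e) = g • F.toEquiv e := by
  obtain ⟨F, hF, hFe⟩ := hπ.exists_map hπ' h h'
  obtain ⟨F', hF', hFe'⟩ := hπ'.exists_map hπ h' h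
  refine ⟨⟨⟨F, F', fun e => ?_, fun e => ?_⟩, hF, hF'⟩, fun e => (hFe e).1, fun g e => ?_⟩
  · exact h.injective hπ ((hFe' _).1.trans (hFe e).1) ((hFe' _).2.trans (hFe e).2)
  · exact h'.injective hπ' ((hFe _).1.trans (hFe' e).1) ((hFe _).2.trans (hFe' e).2)
  · refine h'.injective hπ' ?_ ?_
    · change π' (F (g • e)) = π' (g • F e)
      rw [hπ'.proj_smul, (hFe _).1, (hFe _).1, hπ.proj_smul]
    · change Φ' (F (g • e)) = Φ' (g • F e)
      rw [h'.map_smul, (hFe _).2, (hFe _).2, h.map_smul]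

end Classifying

/-! ### Classifying maps of D-numerable bundles -/

section Numerable

variable {X : Type*} [DiffeologicalSpace X]

theorem IsSmoothPartitionOfUnity.isWeight {ζ : ℕ → X → ℝ} (h : IsSmoothPartitionOfUnity ζ)
    (x : X) : IsWeight fun i => ζ i x :=
  ⟨fun i => h.nonneg i x, h.pointFinite x, h.sum_eq_one x⟩

variable {G : Type u}

theorem joinMk_eq {T T' : ℕ → ℝ} {hT : IsWeight T} {hT' : IsWeight T'} {g g' : ℕ → G}
    (h : ∀ i, T i = T' i) (hg : ∀ i, T i ≠ 0 → g i = g' i) : joinMk T hT g = joinMk T' hT' g' :=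
  EG_ext h fun i hi => by
    rw [weight_joinMk] at hi
    rw [coord_joinMk _ _ hi, coord_joinMk _ _ (by rwa [← h]), hg i hi]

theorem joinMk_eq_self {T : ℕ → ℝ} {hT : IsWeight T} {g : ℕ → G} {e : EG G}
    (h : ∀ i, T i = weight e i) (hg : ∀ i, T i ≠ 0 → g i = coord e i) : joinMk T hT g = e :=
  EG_ext h fun i hi => by
    rw [weight_joinMk] at hi
    rw [coord_joinMk _ _ hi, hg i hi]

variable [Group G]

theorem joinMk_eq_smul {T T' : ℕ → ℝ} {hT : IsWeight T} {hT' : IsWeight T'} {g g' : ℕ → G}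
    {k : G} (h : ∀ i, T i = T' i) (hg : ∀ i, T i ≠ 0 → g i = g' i * k⁻¹) :
    joinMk T hT g = k • joinMk T' hT' g' :=
  EG_ext (fun i => by rw [weight_smul]; exact h i) fun i hi => by
    rw [weight_joinMk] at hi
    have h' : T' i ≠ 0 := by rwa [← h]
    rw [coord_joinMk _ _ hi, coord_smul _ (joinMk T' hT' g') h', coord_joinMk _ _ h', hg i hi]

variable [DiffeologicalSpace G] {E : Type*} [DiffeologicalSpace E] [MulAction G E] {π : E → X}

/-- The fibre `F` of a numerable trivialization is not assumed to be `G`, so no neutral element is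
available. The section is constant in `F`, at the coordinate of an arbitrary point `e₀` over `U`. -/
theorem IsTrivialOver.exists_section {U : Set X} (hU : IsOpen[dTopology] U)
    (hπ : Function.Surjective π) {F : Type*} [DiffeologicalSpace F] (h : IsTrivialOver π U F)
    [Nonempty E] : ∃ s : X → E, DSmoothOn s U ∧ ∀ x ∈ U, π (s x) = x := by
  classical
  obtain ⟨φ, hφ⟩ := h
  by_cases hUe : U.Nonempty
  · obtain ⟨x₀, hx₀⟩ := hUe
    obtain ⟨e₀, he₀⟩ := hπ x₀
    let a := (φ.toEquiv ⟨(⟨x₀, hx₀⟩, e₀), he₀.symm⟩).2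
    let σ : U → E := fun x => (φ.toEquiv.symm (x, a)).1.2
    have hσ : DSmooth σ := smooth_snd.comp (smooth_val.comp
      (φ.smooth_invFun.comp (smooth_pair dSmooth_id dSmooth_const)))
    have hσπ : ∀ x : U, π (σ x) = x := fun x => by
      rw [← (φ.toEquiv.symm (x, a)).2]
      have := hφ (φ.toEquiv.symm (x, a))
      rw [Equiv.apply_symm_apply] at this
      exact congrArg Subtype.val this.symm
    refine ⟨fun x => if hx : x ∈ U then σ ⟨x, hx⟩ else e₀, dSmoothOn_of_subtype hU ?_,
      fun x hx => ?_⟩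
    · have : (fun x : U => if hx : (x : X) ∈ U then σ ⟨x, hx⟩ else e₀) = σ :=
        funext fun x => dif_pos x.2
      rwa [this]
    · simp only [dif_pos hx, hσπ]
  · rw [Set.not_nonempty_iff_eq_empty] at hUe
    subst hUe
    exact ⟨fun _ => Classical.arbitrary E, fun _ _ _ _ hx => hx.elim, fun _ hx => hx.elim⟩

/-- A D-numerable principal bundle has a classifying map. -/
theorem PrincipalCore.exists_classifies_of_isDNumerable (hπ : PrincipalCore G π)
    (h : IsDNumerable π) : ∃ (Φ : E → EG G) (f : X → BG G), DSmooth f ∧ Classifies π Φ f := by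
  suffices ∃ Φ : E → EG G, DSmooth Φ ∧ ∀ (g : G) (e : E), Φ (g • e) = g • Φ e by
    obtain ⟨Φ, h1, h2⟩ := this
    exact ⟨Φ, hπ.exists_classifies h1 h2⟩
  rcases isEmpty_or_nonempty E with hE | hE
  · exact ⟨fun e => isEmptyElim e, fun n p _ => (IsEmpty.false (p 0)).elim, fun _ e => isEmptyElim e⟩
  obtain ⟨F, dF, U, ζ, hU, -, htriv, hfin, hζ, hsupp⟩ := h
  choose s hs hsπ using fun i => (htriv i).exists_section (hU i) hπ.surjective
  have hmem : ∀ i x, ζ i x ≠ 0 → x ∈ U i := fun i x hx =>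
    hsupp i (@subset_closure X dTopology _ x hx)
  -- Milnor's map. Replacing `e` by `g • e` multiplies each quotient by `g⁻¹` on the right, as the
  -- action on `EG` does.
  refine ⟨fun e => joinMk (fun i => ζ i (π e)) (hζ.isWeight _) fun i => quot G e (s i (π e)),
    dSmooth_joinMk _ _ (fun i => (hζ.smooth i).comp hπ.smooth) fun n p hp x => ?_, fun g e => ?_⟩
  · have hπp := hπ.smooth n p hp
    -- Over `U i` the section is smooth. Off `U i` the function `ζ i` vanishes nearby, since its
    -- closed support lies in `U i`, and any plot will do.
    have key : ∀ i, ∃ γ : Eucl n → G, IsPlot γ ∧ ∀ᶠ y in 𝓝 x, ζ i (π (p y)) ≠ 0 →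
        quot G (p y) (s i (π (p y))) = γ y := fun i => by
      by_cases hx : π (p x) ∈ U i
      · obtain ⟨γ, hγ, h1⟩ := hπ.plotAt_quot (plotAt_of_isPlot hp x) (hs i n _ hπp x hx) (by
          filter_upwards [eventually_mem_of_isPlot hπp (hU i) hx] with y hy
          exact (hsπ i _ hy).symm)
        exact ⟨γ, hγ, h1.mono fun y hy _ => hy⟩
      · refine ⟨fun _ => 1, isPlot_const, ?_⟩
        filter_upwards [eventually_eq_zero_of_notMem_dSupport hπp
          fun h => hx (hsupp i h)] with y hy hy'
        exact (hy' hy).elim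
    choose γ hγ hγ' using key
    -- Local finiteness leaves finitely many relevant `i`, whose neighbourhoods can be intersected.
    obtain ⟨I, hI, hIx⟩ := eventually_finite_of_locallyFinite hfin hπp x
    refine ⟨γ, hγ, ?_⟩
    filter_upwards [hIx, (Filter.eventually_all_finite hI).2 fun i _ => hγ' i] with y hy hy' i hi
    exact hy' i (hy i (hmem i _ hi)) hi
  · refine joinMk_eq_smul (fun i => by rw [hπ.proj_smul]) fun i hi => ?_
    rw [hπ.proj_smul] at hi ⊢
    exact hπ.quot_smul_left (hsπ i _ (hmem i _ hi)).symm g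

end Numerable

/-! ### The bundle classified by a map -/

theorem iUnion_baseWeight_ne_zero {X : Type*} {G : Type u} [Group G] (f : X → BG G) :
    ⋃ i, {x | baseWeight (f x) i ≠ 0} = Set.univ :=
  Set.eq_univ_of_forall fun x => Set.mem_iUnion.2 (isWeight_baseWeight (f x)).exists_ne_zero

section Pull

variable {X : Type u} [DiffeologicalSpace X]

theorem SmoothlyParacompact.exists_nat_partition (hX : SmoothlyParacompact X) {U : ℕ → Set X}
    (hU : ∀ i, IsOpen[dTopology] (U i)) (hUc : ⋃ i, U i = Set.univ) :
    ∃ ζ : ℕ → X → ℝ, IsSmoothPartitionOfUnity ζ ∧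
      @LocallyFinite ℕ X dTopology (fun i => {x | ζ i x ≠ 0}) ∧ ∀ i, dSupport (ζ i) ⊆ U i := by
  obtain ⟨ζ, hζ, hfin, hsupp⟩ := hX.exists_partition (ULift.{u} ℕ) (fun i => U i.down)
    (fun i => hU i.down) (by
      rw [← hUc]
      exact Equiv.ulift.surjective.iUnion_comp U)
  refine ⟨fun i => ζ ⟨i⟩, ⟨fun i => hζ.smooth _, fun i => hζ.nonneg _, fun x => ?_, fun x => ?_⟩,
    fun x => ?_, fun i => hsupp _⟩
  · exact (hζ.pointFinite x).preimage ULift.up_injective.injOn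
  · rw [← hζ.sum_eq_one x]
    exact (finsum_comp_equiv (f := fun i => ζ i x) Equiv.ulift.symm :)
  · obtain ⟨t, ht, hfint⟩ := hfin x
    have h1 := Set.Finite.preimage (f := (ULift.up : ℕ → ULift.{u} ℕ)) ULift.up_injective.injOn hfint
    exact ⟨t, ht, h1⟩

variable {G : Type u} [Group G] [DiffeologicalSpace G] [DiffeologicalGroup G]

theorem isOpen_baseWeight_ne_zero {f : X → BG G} (hf : DSmooth f) (i : ℕ) :
    IsOpen[dTopology] {x | baseWeight (f x) i ≠ 0} :=
  isOpen_ne_zero ((smooth_baseWeight i).comp hf)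

/-- The sets where a weight does not vanish carry sections but need not form a locally finite
family; a precise refinement keeps the indices, hence the sections. -/
theorem isDNumerable_pullback_universal (hX : SmoothlyParacompact X) {f : X → BG G}
    (hf : DSmooth f) : IsDNumerable (Pullback.proj f (universalProj : EG G → BG G)) := by
  let _ := pullbackMulAction (universalProj_smul (G := G)) f
  have hcore := universalCore.pullback hf
  obtain ⟨V, hV, hVc, hVfin, hVU⟩ := @precise_refinement ℕ X dTopology hX.paracompact
    (fun i => {x | baseWeight (f x) i ≠ 0}) (isOpen_baseWeight_ne_zero hf)
    (iUnion_baseWeight_ne_zero f)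
  obtain ⟨ζ, hζ, -, hsupp⟩ := hX.exists_nat_partition hV hVc
  refine ⟨G, inferInstance, V, ζ, hV, hVc, fun i => ?_, hVfin, hζ, hsupp⟩
  refine hcore.isTrivialOver
    (q := fun x : V i => ⟨(x, universalSection i (f x)), (universalProj_section i _).symm⟩)
    (smooth_subtype (smooth_pair smooth_val ?_)) fun _ => rfl
  exact fun n p hp => isPlot_of_plotAt fun x =>
    smoothOn_universalSection i n (fun y => f (p y).1) (hf n _ hp) x (hVU i (p x).2)

/-- The principal bundle pulled back from the universal bundle along a smooth map. -/
noncomputable def universalPullback (hX : SmoothlyParacompact X) {f : X → BG G} (hf : DSmooth f) :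
    DNumerableBundle G X where
  total := Pullback f (universalProj : EG G → BG G)
  action := pullbackMulAction universalProj_smul f
  proj := Pullback.proj f universalProj
  isPrincipal :=
    let _ := pullbackMulAction (universalProj_smul (G := G)) f
    (universalCore.pullback hf).isPrincipalBundle
  isDNumerable := isDNumerable_pullback_universal hX hf

theorem classifies_universalPullback (hX : SmoothlyParacompact X) {f : X → BG G}
    (hf : DSmooth f) : Classifies (universalPullback hX hf).proj
      (fun z : Pullback f (universalProj : EG G → BG G) => z.1.2) f :=
  ⟨smooth_snd.comp smooth_val, fun _ _ => rfl, fun z => z.2.symm⟩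

end Pull

/-! ### Moving barycentric coordinates -/

/-- The sequence with `A` in the odd places and `B` in the even places. -/
def interleave {α : Type*} (A B : ℕ → α) (p : ℕ) : α := if p % 2 = 1 then A (p / 2) else B (p / 2)

theorem interleave_finite {A B : ℕ → ℝ} (hA : {i | A i ≠ 0}.Finite) (hB : {i | B i ≠ 0}.Finite) :
    {p | interleave A B p ≠ 0}.Finite := by
  refine ((hA.image fun i => 2 * i + 1).union (hB.image fun i => 2 * i)).subset fun p hp => ?_
  simp only [interleave, Set.mem_ofPred_eq] at hp
  split_ifs at hp with h
  · exact Or.inl ⟨p / 2, hp, by simp only; omega⟩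
  · exact Or.inr ⟨p / 2, hp, by simp only; omega⟩

/-- Finite sums are read as series, which split into even and odd terms. -/
theorem finsum_interleave {A B : ℕ → ℝ} (hA : {i | A i ≠ 0}.Finite) (hB : {i | B i ≠ 0}.Finite) :
    ∑ᶠ p, interleave A B p = ∑ᶠ i, A i + ∑ᶠ i, B i := by
  have h {f : ℕ → ℝ} (hf : {i | f i ≠ 0}.Finite) : ∑ᶠ i, f i = ∑' i, f i :=
    (tsum_eq_finsum hf).symm
  rw [h (interleave_finite hA hB), h hA, h hB, add_comm]
  refine (HasSum.even_add_odd ?_ ?_).tsum_eq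
  · have : (fun k => interleave A B (2 * k)) = B := funext fun k => by
      rw [interleave, if_neg (by omega)]
      congr 1
      omega
    rw [this]
    exact (summable_of_hasFiniteSupport hB).hasSum
  · have : (fun k => interleave A B (2 * k + 1)) = A := funext fun k => by
      rw [interleave, if_pos (by omega)]
      congr 1
      omega
    rw [this]
    exact (summable_of_hasFiniteSupport hA).hasSum

theorem interleave_nonneg {A B : ℕ → ℝ} (hA : ∀ i, 0 ≤ A i) (hB : ∀ i, 0 ≤ B i) (p : ℕ) :
    0 ≤ interleave A B p := by
  unfold interleave
  split_ifs
  exacts [hA _, hB _]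

theorem smooth_interleave {Y Z : Type*} [DiffeologicalSpace Y] [DiffeologicalSpace Z]
    {A B : Y → ℕ → Z} (hA : ∀ i, DSmooth fun y => A y i) (hB : ∀ i, DSmooth fun y => B y i)
    (p : ℕ) : DSmooth fun y => interleave (A y) (B y) p := by
  unfold interleave
  split_ifs
  exacts [hA _, hB _]

theorem smooth_smoothTransition {Y : Type*} [DiffeologicalSpace Y] {f : Y → ℝ}
    (hf : DSmooth f) : DSmooth fun y => Real.smoothTransition (f y) :=
  smooth_contDiff_comp hf Real.smoothTransition.contDiff

theorem finite_mul {T : ℕ → ℝ} (hT : {i | T i ≠ 0}.Finite) (a : ℕ → ℝ) :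
    {i | a i * T i ≠ 0}.Finite := hT.subset fun _ hi => right_ne_zero_of_mul hi

/-! ### Segments from the odd to the even places -/

section Mix

variable {G : Type u}

theorem IsWeight.mix {T T' : ℕ → ℝ} (h : IsWeight T) (h' : IsWeight T') {a : ℝ} (h0 : 0 ≤ a)
    (h1 : a ≤ 1) : IsWeight (interleave (fun i => (1 - a) * T i) fun i => a * T' i) where
  nonneg := interleave_nonneg (fun i => mul_nonneg (by linarith) (h.nonneg i))
    fun i => mul_nonneg h0 (h'.nonneg i)
  finite := interleave_finite (finite_mul h.finite _) (finite_mul h'.finite _)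
  sum := by
    rw [finsum_interleave (finite_mul h.finite _) (finite_mul h'.finite _),
      ← mul_finsum' _ _ h.finite, ← mul_finsum' _ _ h'.finite, h.sum, h'.sum]
    ring

/-- The segment from `e₀`, moved to the odd places, to `e₁`, moved to the even places. -/
noncomputable def mix (τ : ℝ) (e₀ e₁ : EG G) : EG G :=
  joinMk _ ((isWeight_weight e₀).mix (isWeight_weight e₁) (Real.smoothTransition.nonneg τ)
    (Real.smoothTransition.le_one τ)) (interleave (coord e₀) (coord e₁))

/-- At time zero the second point has no weight, so its group coordinates are forgotten. Thus the
start of a segment depends on the first point alone. -/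
theorem mix_zero (e₀ e₁ e₂ : EG G) : mix 0 e₀ e₁ = mix 0 e₀ e₂ := by
  refine joinMk_eq (fun p => ?_) fun p hp => ?_
  · simp [interleave]
  · unfold interleave at hp ⊢
    split_ifs with h <;> simp [h] at hp ⊢

theorem mix_one (e₀ e₁ e₂ : EG G) : mix 1 e₀ e₂ = mix 1 e₁ e₂ := by
  refine joinMk_eq (fun p => ?_) fun p hp => ?_
  · simp [interleave]
  · unfold interleave at hp ⊢
    split_ifs with h <;> simp [h] at hp ⊢

theorem mix_smul [Group G] (τ : ℝ) (e₀ e₁ : EG G) (g : G) :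
    mix τ (g • e₀) (g • e₁) = g • mix τ e₀ e₁ := by
  refine joinMk_eq_smul (fun p => ?_) fun p hp => ?_
  · simp only [weight_smul]
  · unfold interleave at hp ⊢
    simp only [weight_smul] at hp
    split_ifs with h
    · rw [if_pos h] at hp
      exact coord_smul _ _ (right_ne_zero_of_mul hp)
    · rw [if_neg h] at hp
      exact coord_smul _ _ (right_ne_zero_of_mul hp)

theorem smooth_mix [DiffeologicalSpace G] {Y : Type*} [DiffeologicalSpace Y] {τ : Y → ℝ}
    {Φ₀ Φ₁ : Y → EG G} (hτ : DSmooth τ) (h₀ : DSmooth Φ₀) (h₁ : DSmooth Φ₁) :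
    DSmooth fun y => mix (τ y) (Φ₀ y) (Φ₁ y) := by
  have hs := smooth_smoothTransition hτ
  refine dSmooth_joinMk _ _ (fun p => ?_) fun n p hp x => ?_
  · exact smooth_interleave
      (fun i => smooth_mul (smooth_sub dSmooth_const hs) ((smooth_weight i).comp h₀))
      (fun i => smooth_mul hs ((smooth_weight i).comp h₁)) p
  · obtain ⟨γ₀, hγ₀, h2⟩ := exists_coord_plot (plotAt_of_isPlot (h₀ n p hp) x)
    obtain ⟨γ₁, hγ₁, h3⟩ := exists_coord_plot (plotAt_of_isPlot (h₁ n p hp) x)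
    refine ⟨interleave γ₀ γ₁, fun i => ?_, ?_⟩
    · unfold interleave
      split_ifs
      exacts [hγ₀ _, hγ₁ _]
    · filter_upwards [h2, h3] with y hy₀ hy₁ i hi
      unfold interleave at hi ⊢
      split_ifs with h
      · rw [if_pos h] at hi
        exact hy₀ _ (right_ne_zero_of_mul hi)
      · rw [if_neg h] at hi
        exact hy₁ _ (right_ne_zero_of_mul hi)

end Mix

/-! ### Moving the `i`-th coordinate to the place `2 * i + 1` -/

section Slide

variable {G : Type u}

/-- The proportion of the `i`-th coordinate that has moved at the time `τ`. -/
noncomputable def moved (i : ℕ) (τ : ℝ) : ℝ := Real.smoothTransition (4 ^ (i + 1) * τ - 2)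

theorem moved_nonneg (i : ℕ) (τ : ℝ) : 0 ≤ moved i τ := Real.smoothTransition.nonneg _

theorem moved_le_one (i : ℕ) (τ : ℝ) : moved i τ ≤ 1 := Real.smoothTransition.le_one _

theorem moved_eq_zero {i : ℕ} {τ : ℝ} (h : 4 ^ (i + 1) * τ ≤ 2) : moved i τ = 0 :=
  Real.smoothTransition.zero_of_nonpos (by linarith)

theorem moved_eq_one {i : ℕ} {τ : ℝ} (h : 3 ≤ 4 ^ (i + 1) * τ) : moved i τ = 1 :=
  Real.smoothTransition.one_of_one_le (by linarith)

/-- Total weight is preserved: what leaves the place `i` arrives at `2 * i + 1`. -/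
theorem IsWeight.slide {T : ℕ → ℝ} (h : IsWeight T) (τ : ℝ) : IsWeight fun p =>
    (1 - moved p τ) * T p + interleave (fun i => moved i τ * T i) (fun _ => 0) p := by
  have h0 : {i : ℕ | (0 : ℝ) ≠ 0}.Finite := by simp
  have hA := finite_mul h.finite fun i => 1 - moved i τ
  have hB := finite_mul h.finite fun i => moved i τ
  refine IsWeight.add (fun i => mul_nonneg (by linarith [moved_le_one i τ]) (h.nonneg i))
    (interleave_nonneg (fun i => mul_nonneg (moved_nonneg i τ) (h.nonneg i)) fun _ => le_rfl)
    hA (interleave_finite hB h0) ?_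
  rw [finsum_interleave hB h0, finsum_zero, add_zero, ← finsum_add_distrib hA hB]
  exact (finsum_congr fun i => by ring).trans h.sum

/-- The index of the coordinate that is at the place `p` at the time `τ`. -/
noncomputable def slideIndex (τ : ℝ) (p : ℕ) : ℕ :=
  open Classical in if 4 ^ p * τ < 1 then p else p / 2

/-- The point `e` with its coordinates moved as far as they get until the time `τ`. -/
noncomputable def slide (τ : ℝ) (e : EG G) : EG G :=
  joinMk _ ((isWeight_weight e).slide τ) fun p => coord e (slideIndex τ p)

/-- A place that is occupied at the time `τ` is occupied either by the coordinate that has not yet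
moved away, or by the one that has moved there. -/
theorem slide_cases {T : ℕ → ℝ} {τ : ℝ} {p : ℕ}
    (h : (1 - moved p τ) * T p + interleave (fun i => moved i τ * T i) (fun _ => 0) p ≠ 0) :
    (4 ^ (p + 1) * τ < 3 ∧ T p ≠ 0) ∨ (p % 2 = 1 ∧ 2 < 4 ^ (p / 2 + 1) * τ ∧ T (p / 2) ≠ 0) := by
  by_cases h1 : (1 - moved p τ) * T p = 0
  · right
    rw [h1, zero_add, interleave] at h
    split_ifs at h with h2
    · refine ⟨h2, ?_, right_ne_zero_of_mul h⟩
      by_contra h3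
      exact left_ne_zero_of_mul h (moved_eq_zero (not_lt.1 h3))
    · exact (h rfl).elim
  · left
    refine ⟨?_, right_ne_zero_of_mul h1⟩
    by_contra h3
    exact left_ne_zero_of_mul h1 (by rw [moved_eq_one (not_lt.1 h3), sub_self])

/-- Since `p` is odd, `p / 2 + 1 ≤ p`, so the arrival condition can be compared with the departure
condition at the same power of `4`. -/
theorem two_lt_of_two_lt {p : ℕ} {τ : ℝ} (hp : p % 2 = 1) (h : 2 < 4 ^ (p / 2 + 1) * τ) :
    2 < 4 ^ p * τ := by
  have hτ : 0 < τ := by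
    by_contra h0
    have : 4 ^ (p / 2 + 1) * τ ≤ 0 := mul_nonpos_of_nonneg_of_nonpos (by positivity) (not_lt.1 h0)
    linarith
  refine h.trans_le (mul_le_mul_of_nonneg_right ?_ hτ.le)
  exact pow_le_pow_right₀ (by norm_num) (by omega)

theorem lt_of_lt_three {p : ℕ} {τ : ℝ} (h : 4 ^ (p + 1) * τ < 3) : 4 ^ p * τ < 3 / 4 := by
  rw [pow_succ] at h
  linarith

/-- The old coordinate occupies the place `p` only while `4 ^ p * τ < 3 / 4`, and the new one only
once `4 ^ p * τ > 2`. The threshold `1` in `slideIndex` lies strictly between, so it names the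
occupant, and no place ever holds two coordinates. -/
theorem weight_slideIndex_ne_zero {T : ℕ → ℝ} {τ : ℝ} {p : ℕ}
    (h : (1 - moved p τ) * T p + interleave (fun i => moved i τ * T i) (fun _ => 0) p ≠ 0) :
    T (slideIndex τ p) ≠ 0 := by
  unfold slideIndex
  rcases slide_cases h with ⟨h1, h2⟩ | ⟨h1, h2, h3⟩
  · rwa [if_pos (by linarith [lt_of_lt_three h1])]
  · rwa [if_neg (by linarith [two_lt_of_two_lt h1 h2])]

theorem slide_zero (e : EG G) : slide 0 e = e := by
  have h0 : ∀ i, moved i 0 = 0 := fun i => moved_eq_zero (by norm_num)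
  refine joinMk_eq_self (fun p => ?_) fun p _ => ?_
  · simp [h0, interleave]
  · simp [slideIndex]

theorem slide_one (e : EG G) : slide 1 e = mix 0 e e := by
  have h0 : ∀ i, moved i 1 = 1 := fun i => moved_eq_one (by
    have : (1 : ℝ) ≤ 4 ^ i := one_le_pow₀ (by norm_num)
    rw [pow_succ]
    linarith)
  refine joinMk_eq (fun p => ?_) fun p _ => ?_
  · simp [h0, interleave]
  · have : (1 : ℝ) ≤ 4 ^ p := one_le_pow₀ (by norm_num)
    rw [slideIndex, if_neg (by linarith), interleave, ite_self]

theorem slide_smul [Group G] (τ : ℝ) (e : EG G) (g : G) : slide τ (g • e) = g • slide τ e := by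
  refine joinMk_eq_smul (fun p => ?_) fun p hp => ?_
  · simp only [weight_smul]
  · simp only [weight_smul] at hp
    exact coord_smul _ _ (weight_slideIndex_ne_zero hp)

/-- The weights are visibly smooth; the point is that `slideIndex` is locally constant in time on
occupied places, uniformly in the place. -/
theorem smooth_slide [DiffeologicalSpace G] {E : Type*} [DiffeologicalSpace E] {Φ : E → EG G}
    (hΦ : DSmooth Φ) (hfin : ∀ (n : ℕ) (p : Eucl n → E), IsPlot p → ∀ x, ∃ I : Set ℕ, I.Finite ∧
      ∀ᶠ y in 𝓝 x, ∀ i, weight (Φ (p y)) i ≠ 0 → i ∈ I) :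
    DSmooth fun z : E × ℝ => slide z.2 (Φ z.1) := by
  have hm : ∀ i, DSmooth fun z : E × ℝ => moved i z.2 := fun i =>
    smooth_smoothTransition (smooth_sub (smooth_mul dSmooth_const smooth_snd) dSmooth_const)
  have hw : ∀ i, DSmooth fun z : E × ℝ => weight (Φ z.1) i := fun i =>
    (smooth_weight i).comp (hΦ.comp smooth_fst)
  refine dSmooth_joinMk _ _ (fun p => ?_) fun n p hp x => ?_
  · exact smooth_add (smooth_mul (smooth_sub dSmooth_const (hm p)) (hw p))
      (smooth_interleave (fun i => smooth_mul (hm i) (hw i)) (fun i => dSmooth_const) p)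
  · obtain ⟨γ, hγ, h1⟩ := exists_coord_plot (plotAt_of_isPlot (hΦ n _ hp.1) x)
    have hτc : Continuous fun y => (p y).2 := hp.2.contDiff.continuous
    obtain ⟨I, hI, hIx⟩ := hfin n _ hp.1 x
    set τ₀ := (p x).2 with hτ₀
    refine ⟨fun i => γ (slideIndex τ₀ i), fun i => hγ _, ?_⟩
    suffices ∀ᶠ y in 𝓝 x, ∀ i, (1 - moved i (p y).2) * weight (Φ (p y).1) i +
        interleave (fun i => moved i (p y).2 * weight (Φ (p y).1) i) (fun _ => 0) i ≠ 0 →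
        slideIndex (p y).2 i = slideIndex τ₀ i by
      filter_upwards [h1, this] with y hy hy' i hi
      rw [← hy' i hi]
      exact hy _ (weight_slideIndex_ne_zero hi)
    -- For `τ₀ > 0`, the bounds `3 / 4 * τ₀ < τ < 2 * τ₀` turn the gap between `3 / 4` and `2` at
    -- time `τ` into the right side of `1` at time `τ₀`, for all places at once. For `τ₀ ≤ 0`, the
    -- finitely many coordinates with non-zero weight have not begun to move near `x`.
    by_cases hpos : 0 < τ₀
    · have e1 : ∀ᶠ y in 𝓝 x, 3 / 4 * τ₀ < (p y).2 :=
        hτc.continuousAt.eventually_const_lt (by linarith)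
      have e2 : ∀ᶠ y in 𝓝 x, (p y).2 < 2 * τ₀ :=
        hτc.continuousAt.eventually_lt_const (by linarith)
      filter_upwards [e1, e2] with y hy1 hy2 i hi
      have h4 : (0 : ℝ) < 4 ^ i := by positivity
      have h5 := mul_lt_mul_of_pos_left hy1 h4
      have h6 := mul_lt_mul_of_pos_left hy2 h4
      unfold slideIndex
      rcases slide_cases hi with ⟨h1, h2⟩ | ⟨h1, h2, h3⟩
      · have := lt_of_lt_three h1
        rw [if_pos (by linarith), if_pos (by linarith)]
      · have := two_lt_of_two_lt h1 h2
        rw [if_neg (by linarith), if_neg (by linarith)]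
    · have e1 : ∀ᶠ y in 𝓝 x, ∀ i ∈ I, 4 ^ (i + 1) * (p y).2 < 2 := by
        refine (Filter.eventually_all_finite hI).2 fun i _ => ?_
        refine (hτc.const_mul (4 ^ (i + 1))).continuousAt.eventually_lt_const ?_
        have : 4 ^ (i + 1) * τ₀ ≤ 0 :=
          mul_nonpos_of_nonneg_of_nonpos (by positivity) (not_lt.1 hpos)
        linarith
      filter_upwards [e1, hIx] with y hy1 hy2 i hi
      have h7 : 4 ^ i * τ₀ ≤ 0 := mul_nonpos_of_nonneg_of_nonpos (by positivity) (not_lt.1 hpos)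
      unfold slideIndex
      rcases slide_cases hi with ⟨h1, h2⟩ | ⟨h1, h2, h3⟩
      · have := lt_of_lt_three h1
        rw [if_pos (by linarith), if_pos (by linarith)]
      · linarith [hy1 _ (hy2 _ h3)]

end Slide

/-! ### Uniqueness of classifying maps up to homotopy -/

section Uniqueness

variable {G : Type u} [Group G] [DiffeologicalSpace G] [DiffeologicalGroup G] {X : Type u}
  [DiffeologicalSpace X] {E : Type u} [DiffeologicalSpace E] [MulAction G E] {π : E → X}

/-- A classifying map is homotopic to one with locally finitely many non-zero weights. -/
theorem PrincipalCore.exists_locallyFinite (hπ : PrincipalCore G π) (hX : SmoothlyParacompact X)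
    {Φ : E → EG G} {f : {f : X → BG G // DSmooth f}} (h : Classifies π Φ f.1) :
    ∃ (Φ' : E → EG G) (f' : {f : X → BG G // DSmooth f}), Classifies π Φ' f'.1 ∧
      SmoothHomotopic f f' ∧ ∀ (n : ℕ) (p : Eucl n → E), IsPlot p → ∀ x, ∃ I : Set ℕ,
        I.Finite ∧ ∀ᶠ y in 𝓝 x, ∀ i, weight (Φ' (p y)) i ≠ 0 → i ∈ I := by
  obtain ⟨ζ, hζ, hfin, hsupp⟩ := hX.exists_nat_partition (isOpen_baseWeight_ne_zero f.2)
    (iUnion_baseWeight_ne_zero f.1)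
  -- The new weights are supported where the old ones are non-zero, so the old group coordinates
  -- serve throughout the linear homotopy of weights.
  have hζw : ∀ e i, ζ i (π e) ≠ 0 → weight (Φ e) i ≠ 0 := fun e i hi => by
    have h1 : baseWeight (f.1 (π e)) i ≠ 0 :=
      hsupp i (@subset_closure X dTopology {x | ζ i x ≠ 0} (π e) hi)
    rwa [← h.proj] at h1
  let T : E × ℝ → ℕ → ℝ := fun z i => (1 - Real.smoothTransition z.2) * weight (Φ z.1) i +
    Real.smoothTransition z.2 * ζ i (π z.1)
  have hT : ∀ z, IsWeight (T z) := fun z => (isWeight_weight _).convex (hζ.isWeight _)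
    (Real.smoothTransition.nonneg _) (Real.smoothTransition.le_one _)
  have hTw : ∀ z i, T z i ≠ 0 → weight (Φ z.1) i ≠ 0 := fun z i hi h0 => by
    have h1 : ζ i (π z.1) = 0 := by
      by_contra h1
      exact hζw _ _ h1 h0
    exact hi (by simp only [T, h0, h1, mul_zero, add_zero])
  let Ψ : E × ℝ → EG G := fun z => joinMk (T z) (hT z) (coord (Φ z.1))
  have hs : DSmooth fun z : E × ℝ => Real.smoothTransition z.2 := smooth_smoothTransition smooth_snd
  have hΨ : DSmooth Ψ := by
    refine dSmooth_joinMk _ _ (fun i => smooth_add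
      (smooth_mul (smooth_sub dSmooth_const hs) ((smooth_weight i).comp (h.smooth.comp smooth_fst)))
      (smooth_mul hs ((hζ.smooth i).comp (hπ.smooth.comp smooth_fst)))) fun n p hp x => ?_
    obtain ⟨γ, hγ, h1⟩ := exists_coord_plot (plotAt_of_isPlot (h.smooth n _ hp.1) x)
    exact ⟨γ, hγ, h1.mono fun y hy i hi => hy i (hTw _ _ hi)⟩
  have hΨG : ∀ (g : G) (e : E) (τ : ℝ), Ψ (g • e, τ) = g • Ψ (e, τ) := fun g e τ => by
    refine joinMk_eq_smul (fun i => ?_) fun i hi => ?_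
    · simp only [T, h.map_smul, weight_smul, hπ.proj_smul]
    · have h1 := hTw _ _ hi
      simp only [h.map_smul, weight_smul] at h1 ⊢
      exact coord_smul _ _ h1
  obtain ⟨f', hf', hΨf'⟩ := hπ.exists_classifies
    (hΨ.comp' (smooth_pair dSmooth_id (dSmooth_const (y := (1 : ℝ))))) fun g e => hΨG g e 1
  refine ⟨fun e => Ψ (e, 1), ⟨f', hf'⟩, hΨf', hπ.homotopic h hΨf' hΨ hΨG (fun e => ?_)
    fun e => rfl, fun n p hp x => ?_⟩
  · exact joinMk_eq_self (fun i => by simp [T]) fun _ _ => rfl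
  · obtain ⟨I, hI, hIx⟩ := eventually_finite_of_locallyFinite hfin (hπ.smooth n p hp) x
    refine ⟨I, hI, hIx.mono fun y hy i hi => hy i ?_⟩
    simpa [Ψ, T] using hi

/-- Classifying maps of the same principal bundle are homotopic. -/
theorem PrincipalCore.homotopyClass_eq (hπ : PrincipalCore G π) (hX : SmoothlyParacompact X)
    {Φ₀ Φ₁ : E → EG G} {f₀ f₁ : {f : X → BG G // DSmooth f}} (h₀ : Classifies π Φ₀ f₀.1)
    (h₁ : Classifies π Φ₁ f₁.1) :
    (Quot.mk _ f₀ : HomotopyClasses X (BG G)) = Quot.mk _ f₁ := by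
  have mixClass : ∀ {Φ Φ' : E → EG G} {f f' : X → BG G}, Classifies π Φ f → Classifies π Φ' f' →
      ∀ τ, ∃ k : {k : X → BG G // DSmooth k}, Classifies π (fun e => mix τ (Φ e) (Φ' e)) k.1 :=
    fun h h' τ => by
      obtain ⟨k, hk, hk'⟩ := hπ.exists_classifies
        (smooth_mix (dSmooth_const (y := τ)) h.smooth h'.smooth)
        fun g e => by rw [h.map_smul, h'.map_smul, mix_smul]
      exact ⟨⟨k, hk⟩, hk'⟩
  have mixHom : ∀ {Φ Φ' : E → EG G} {f f' : X → BG G}, Classifies π Φ f → Classifies π Φ' f' →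
      ∀ {k k' : {k : X → BG G // DSmooth k}}, Classifies π (fun e => mix 0 (Φ e) (Φ e)) k.1 →
      Classifies π (fun e => mix 1 (Φ' e) (Φ' e)) k'.1 → SmoothHomotopic k k' :=
    fun {Φ Φ' f f'} h h' {k k'} hk hk' => by
      refine hπ.homotopic hk hk' (Ψ := fun z => mix z.2 (Φ z.1) (Φ' z.1))
        (smooth_mix smooth_snd (h.smooth.comp smooth_fst) (h'.smooth.comp smooth_fst))
        (fun g e τ => ?_) (fun e => mix_zero _ _ _) fun e => mix_one _ _ _
      simp only [h.map_smul, h'.map_smul, mix_smul]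
  have odd : ∀ {Φ : E → EG G} {f : {f : X → BG G // DSmooth f}}, Classifies π Φ f.1 →
      ∃ (Φ' : E → EG G) (f' k : {f : X → BG G // DSmooth f}), Classifies π Φ' f'.1 ∧
        Classifies π (fun e => mix 0 (Φ' e) (Φ' e)) k.1 ∧
        (Quot.mk _ f : HomotopyClasses X (BG G)) = Quot.mk _ k := fun {Φ f} h => by
    obtain ⟨Φ', f', h', hff', hfin⟩ := hπ.exists_locallyFinite hX h
    obtain ⟨k, hk⟩ := mixClass h' h' 0
    refine ⟨Φ', f', k, h', hk, (Quot.sound hff').trans (Quot.sound ?_)⟩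
    refine hπ.homotopic h' hk (smooth_slide h'.smooth hfin) (fun g e τ => ?_)
      (fun e => slide_zero _) fun e => slide_one _
    simp only [h'.map_smul, slide_smul]
  -- The odd copies of both maps are homotopic to the same even copy of `Φ₁'`, classified by `l`; so
  -- no slide to the even places is needed.
  obtain ⟨Φ₀', f₀', k₀, h₀', hk₀, e₀⟩ := odd h₀
  obtain ⟨Φ₁', f₁', k₁, h₁', hk₁, e₁⟩ := odd h₁
  obtain ⟨l, hl⟩ := mixClass h₁' h₁' 1
  rw [e₀, e₁]
  exact (Quot.sound (mixHom h₀' h₁' hk₀ hl)).trans (Quot.sound (mixHom h₁' h₁' hk₁ hl)).symm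

end Uniqueness

/-! ### The covering homotopy theorem -/

/-- The tube lemma for the D-topology of a cylinder. -/
theorem isOpen_tube {X : Type*} [DiffeologicalSpace X] {W : Set (X × ℝ)}
    (hW : IsOpen[dTopology] W) {K : Set ℝ} (hK : IsCompact K) :
    IsOpen[dTopology] {x | ∀ τ ∈ K, (x, τ) ∈ W} := by
  refine isOpen_iff_preimages_plots.2 fun n p hp => ?_
  -- The D-topology of the cylinder is tested on the plot `p × id`, whose domain is identified with
  -- a Euclidean space; the usual tube lemma then applies there.
  have hA : IsOpen {z : Eucl n × ℝ | (p z.1, z.2) ∈ W} := by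
    let e := toEuclidean (E := Eucl n × ℝ)
    have hq : IsPlot fun w => (p (e.symm w).1, (e.symm w).2) :=
      ⟨isPlot_reparam hp (contDiff_fst.comp e.symm.contDiff),
        (contDiff_snd.comp e.symm.contDiff).isPlot⟩
    have h1 := (isOpen_iff_preimages_plots.1 hW _ _ hq).preimage e.continuous
    convert h1 using 1
    ext z
    simp
  refine isOpen_iff_eventually.2 fun y hy => ?_
  exact hK.eventually_forall_of_forall_eventually fun τ hτ => hA.mem_nhds (hy τ hτ)

theorem isOpen_slice {X : Type*} [DiffeologicalSpace X] {W : Set (X × ℝ)}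
    (hW : IsOpen[dTopology] W) (x : X) : IsOpen {τ : ℝ | (x, τ) ∈ W} :=
  isOpen_preimage (f := fun τ : ℝ => (x, τ)) (smooth_pair dSmooth_const dSmooth_id) hW

/-- A smooth retraction of `[a, ∞)` into `[a, a + ε]` that fixes the beginning of the interval. -/
theorem exists_smooth_squash (a : ℝ) {ε : ℝ} (hε : 0 < ε) : ∃ μ : ℝ → ℝ,
    ContDiff ℝ (⊤ : ℕ∞) μ ∧ (∀ τ ≤ a + ε / 2, μ τ = τ) ∧
      ∀ τ, a ≤ τ → a ≤ μ τ ∧ μ τ ≤ a + ε ∧ μ τ ≤ τ := by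
  -- From `a + ε` on, `ψ` is `1` and `μ` stays at `a + ε / 2`.
  let ψ : ℝ → ℝ := fun τ => Real.smoothTransition ((τ - (a + ε / 2)) / (ε / 2))
  have hψ : ContDiff ℝ (⊤ : ℕ∞) ψ :=
    Real.smoothTransition.contDiff.comp ((contDiff_id.sub contDiff_const).div_const _)
  have hμ : ∀ τ ≤ a + ε / 2, ψ τ = 0 := fun τ hτ =>
    Real.smoothTransition.zero_of_nonpos (div_nonpos_of_nonpos_of_nonneg (by linarith)
      (by linarith))
  have hμ' : ∀ τ, a + ε ≤ τ → ψ τ = 1 := fun τ hτ =>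
    Real.smoothTransition.one_of_one_le (by rw [le_div_iff₀ (by linarith)]; linarith)
  refine ⟨fun τ => τ - ψ τ * (τ - (a + ε / 2)),
    contDiff_id.sub (hψ.mul (contDiff_id.sub contDiff_const)), fun τ hτ => by simp [hμ τ hτ],
    fun τ hτ => ?_⟩
  have h0 : 0 ≤ ψ τ := Real.smoothTransition.nonneg _
  have h1 : ψ τ ≤ 1 := Real.smoothTransition.le_one _
  simp only
  rcases le_total τ (a + ε / 2) with h | h
  · rw [hμ τ h]
    refine ⟨?_, ?_, ?_⟩ <;> linarith
  · have h2 : 0 ≤ τ - (a + ε / 2) := by linarith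
    have h3 : ψ τ * (τ - (a + ε / 2)) ≤ τ - (a + ε / 2) := mul_le_of_le_one_left h2 h1
    have h4 : 0 ≤ ψ τ * (τ - (a + ε / 2)) := mul_nonneg h0 h2
    refine ⟨by linarith, ?_, by linarith⟩
    rcases le_total (a + ε) τ with h5 | h5
    · rw [hμ' τ h5]
      linarith
    · linarith

/-! ### Local lifts of a homotopy -/

section Lift

variable {G : Type u} [Group G] [DiffeologicalSpace G] [DiffeologicalGroup G] {X : Type*}
  [DiffeologicalSpace X]

/-- The map `s` is a smooth lift of `H` to the universal bundle over `S`. -/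
structure IsLiftOn {Y : Type*} [DiffeologicalSpace Y] (H : Y → BG G) (s : Y → EG G)
    (S : Set Y) : Prop where
  smoothOn : DSmoothOn s S
  proj : ∀ z ∈ S, universalProj (s z) = H z

/-- Lifts over two overlapping time intervals can be joined. -/
theorem IsLiftOn.glue {H : X × ℝ → BG G} {s σ : X × ℝ → EG G} {U U' : Set X}
    (hU : IsOpen[dTopology] U) {a b ε : ℝ} (ha : 0 ≤ a) (hε : 0 < ε)
    (hs : IsLiftOn H s (U ×ˢ Set.Icc 0 (a + ε))) (hσ : DSmoothOn σ (U' ×ˢ Set.Icc a b))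
    (hσH : ∀ z, universalProj (σ z) = H z) :
    ∃ s' : X × ℝ → EG G, IsLiftOn H s' ((U ∩ U') ×ˢ Set.Icc 0 b) := by
  classical
  obtain ⟨μ, hμ, hμid, hμle⟩ := exists_smooth_squash a hε
  -- The group element that carries `σ` to `s` is taken at the squashed time, where both are smooth,
  -- and so makes sense for all later times. Up to `a + ε / 2` the squash is the identity and `tr`
  -- equals `s`; the switch at `a + ε / 4` lies inside this overlap.
  let tr : X × ℝ → EG G := fun z => quot G (σ (z.1, μ z.2)) (s (z.1, μ z.2)) • σ z
  have hμU : ∀ z : X × ℝ, z.1 ∈ U → a ≤ z.2 → (z.1, μ z.2) ∈ U ×ˢ Set.Icc 0 (a + ε) :=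
    fun z hz hz2 => ⟨hz, ha.trans (hμle _ hz2).1, (hμle _ hz2).2.1⟩
  have hproj : ∀ z : X × ℝ, z.1 ∈ U → a ≤ z.2 →
      universalProj (σ (z.1, μ z.2)) = universalProj (s (z.1, μ z.2)) := fun z hz hz2 => by
    rw [hσH, hs.proj _ (hμU z hz hz2)]
  refine ⟨fun z => if z.2 ≤ a + ε / 4 then s z else tr z, fun n p hp x hx => ?_,
    fun z hz => ?_⟩
  · have hτ : Continuous fun y => (p y).2 := hp.2.contDiff.continuous
    have hxU : ∀ᶠ y in 𝓝 x, (p y).1 ∈ U := eventually_mem_of_isPlot hp.1 hU hx.1.1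
    rcases lt_or_ge (p x).2 (a + ε / 2) with h | h
    · refine (hs.smoothOn n p hp x ⟨hx.1.1, hx.2.1, by linarith⟩).congr ?_
      filter_upwards [hxU, hτ.continuousAt.eventually_lt_const h] with y hy hy2
      split_ifs with h1
      · rfl
      · have h2 : a ≤ (p y).2 := by linarith
        have h3 := universalCore.quot_smul (hproj _ hy h2)
        simp only [tr]
        rw [hμid _ hy2.le] at h3 ⊢
        exact h3
    · have hxa : a ≤ (p x).2 := by linarith
      have hμp : IsPlot fun y => ((p y).1, μ (p y).2) :=
        ⟨hp.1, (hμ.comp hp.2.contDiff).isPlot⟩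
      have hμx : ((p x).1, μ (p x).2) ∈ U' ×ˢ Set.Icc a b :=
        ⟨hx.1.2, (hμle _ hxa).1, (hμle _ hxa).2.2.trans hx.2.2⟩
      have hgt : ∀ᶠ y in 𝓝 x, a + ε / 4 < (p y).2 :=
        hτ.continuousAt.eventually_const_lt (by linarith)
      refine (universalCore.plotAt_smul (universalCore.plotAt_quot (hσ n _ hμp x hμx)
        (hs.smoothOn n _ hμp x (hμU _ hx.1.1 hxa)) ?_)
        (hσ n p hp x ⟨hx.1.2, hxa, hx.2.2⟩)).congr ?_
      · filter_upwards [hxU, hgt] with y hy hy2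
        exact hproj _ hy (by linarith)
      · filter_upwards [hgt] with y hy
        rw [if_neg (not_le.2 hy)]
  · split_ifs with h
    · exact hs.proj z ⟨hz.1.1, hz.2.1, by linarith⟩
    · exact (universalProj_smul _ _).trans (hσH z)

/-- A smooth homotopy lifts to the universal bundle locally in the first variable. -/
theorem exists_isLiftOn {H : X × ℝ → BG G} (hH : DSmooth H) (x : X) :
    ∃ U : Set X, IsOpen[dTopology] U ∧ x ∈ U ∧ ∃ s : X × ℝ → EG G,
      IsLiftOn H s (U ×ˢ Set.Icc 0 1) := by
  let W : ℕ → Set (X × ℝ) := fun i => {z | baseWeight (H z) i ≠ 0}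
  have hW : ∀ i, IsOpen[dTopology] (W i) := fun i =>
    isOpen_ne_zero ((smooth_baseWeight i).comp hH)
  have hσ : ∀ i, DSmoothOn (fun z => universalSection i (H z)) (W i) := fun i n p hp x hx =>
    smoothOn_universalSection i n _ (hH n p hp) x hx
  have hnear : ∀ i (b : ℝ), (x, b) ∈ W i → ∃ ε > 0, ∀ τ ∈ Set.Icc b (b + ε), (x, τ) ∈ W i :=
    fun i b hb => by
      obtain ⟨r, hr, hrW⟩ := Metric.isOpen_iff.1 (isOpen_slice (hW i) x) b hb
      refine ⟨r / 2, by linarith, fun τ hτ => hrW ?_⟩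
      rw [Metric.mem_ball, Real.dist_eq, abs_of_nonneg (by linarith [hτ.1])]
      linarith [hτ.2]
  obtain ⟨t, ht0, htm, ⟨m, hm⟩, ht⟩ := exists_monotone_Icc_subset_open_cover_Icc
    (zero_le_one (α := ℝ)) (c := fun i => {τ : Set.Icc (0 : ℝ) 1 | (x, (τ : ℝ)) ∈ W i})
    (fun i => (isOpen_slice (hW i) x).preimage continuous_subtype_val)
    (fun τ _ => Set.mem_iUnion.2 (isWeight_baseWeight (H (x, τ))).exists_ne_zero)
  -- Each stage lifts a little beyond `t n`, so that it overlaps the universal section used on the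
  -- next interval. The neighbourhood of `x` shrinks finitely often.
  have key : ∀ n, ∃ ε > 0, ∃ U : Set X, IsOpen[dTopology] U ∧ x ∈ U ∧ ∃ s : X × ℝ → EG G,
      IsLiftOn H s (U ×ˢ Set.Icc 0 ((t n : ℝ) + ε)) := fun n => by
    induction n with
    | zero =>
      obtain ⟨i, hi⟩ := (isWeight_baseWeight (H (x, 0))).exists_ne_zero
      obtain ⟨ε, hε, hεW⟩ := hnear i 0 hi
      refine ⟨ε, hε, _, isOpen_tube (hW i) (isCompact_Icc (a := 0) (b := 0 + ε)), hεW,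
        fun z => universalSection i (H z), (hσ i).mono ?_, fun z _ => universalProj_section _ _⟩
      rintro ⟨y, τ⟩ ⟨hy, hτ⟩
      rw [ht0] at hτ
      exact hy τ hτ
    | succ n ih =>
      obtain ⟨ε, hε, U, hU, hxU, s, hs⟩ := ih
      obtain ⟨i, hi⟩ := ht n
      have hle : t n ≤ t (n + 1) := htm n.le_succ
      obtain ⟨ε', hε', hεW⟩ := hnear i (t (n + 1)) (hi ⟨hle, le_rfl⟩)
      let U' : Set X := {y | ∀ τ ∈ Set.Icc (t n : ℝ) (t (n + 1) + ε'), (y, τ) ∈ W i}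
      have hU' : IsOpen[dTopology] U' := isOpen_tube (hW i) isCompact_Icc
      have hxU' : x ∈ U' := fun τ hτ => by
        rcases le_total τ (t (n + 1) : ℝ) with h | h
        · exact hi (show (⟨τ, (t n).2.1.trans hτ.1, h.trans (t (n + 1)).2.2⟩ :
            Set.Icc (0 : ℝ) 1) ∈ Set.Icc (t n) (t (n + 1)) from ⟨hτ.1, h⟩)
        · exact hεW τ ⟨h, hτ.2⟩
      obtain ⟨s', hs'⟩ := hs.glue hU (t n).2.1 hε (U' := U') (b := t (n + 1) + ε')
        ((hσ i).mono fun z hz => hz.1 z.2 hz.2) fun z => universalProj_section _ _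
      exact ⟨ε', hε', U ∩ U', @IsOpen.inter X dTopology _ _ hU hU', ⟨hxU, hxU'⟩, s', hs'⟩
  obtain ⟨ε, hε, U, hU, hxU, s, hs⟩ := key m
  have h1 : U ×ˢ Set.Icc (0 : ℝ) 1 ⊆ U ×ˢ Set.Icc 0 ((t m : ℝ) + ε) :=
    Set.prod_mono_right (Set.Icc_subset_Icc_right (by rw [hm m le_rfl]; linarith))
  exact ⟨U, hU, hxU, s, hs.smoothOn.mono h1, fun z hz => hs.proj z (h1 hz)⟩

end Lift

theorem IsWeight.sum_range_le_one {T : ℕ → ℝ} (h : IsWeight T) (n : ℕ) :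
    ∑ i ∈ Finset.range n, T i ≤ 1 := by
  rw [← h.sum, finsum_eq_sum_of_support_subset (s := Finset.range n ∪ h.finite.toFinset) T
    fun i hi => by simpa using Or.inr hi]
  exact Finset.sum_le_sum_of_subset_of_nonneg Finset.subset_union_left fun i _ _ => h.nonneg i

theorem IsWeight.sum_range_eq_one {T : ℕ → ℝ} (h : IsWeight T) {n : ℕ}
    (hn : ∀ i, n ≤ i → T i = 0) : ∑ i ∈ Finset.range n, T i = 1 := by
  rw [← h.sum, finsum_eq_sum_of_support_subset T fun i hi => ?_]
  by_contra h0
  exact hi (hn i (by simpa using h0))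

/-! ### Global transport of classifying maps along a homotopy -/

section Cover

variable {G : Type u} [Group G] [DiffeologicalSpace G] [DiffeologicalGroup G] {X : Type u}
  [DiffeologicalSpace X] {E : Type*} [DiffeologicalSpace E] [MulAction G E] {π : E → X}

/-- A classifying map can be transported along a homotopy inside an open set over which the
homotopy has a lift. -/
theorem PrincipalCore.exists_transport (hπ : PrincipalCore G π) {H : X × ℝ → BG G} {V : Set X}
    (hV : IsOpen[dTopology] V) {s : X × ℝ → EG G} (hs : IsLiftOn H s (V ×ˢ Set.Icc 0 1))
    {η ρ ρ' : X → ℝ} (hη : dSupport η ⊆ V) (hρ : DSmooth ρ) (hρ' : DSmooth ρ')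
    (hρI : ∀ x, ρ x ∈ Set.Icc (0 : ℝ) 1) (hρI' : ∀ x, ρ' x ∈ Set.Icc (0 : ℝ) 1)
    (hρη : ∀ x, η x = 0 → ρ' x = ρ x) {Φ : E → EG G} (h : Classifies π Φ fun x => H (x, ρ x)) :
    ∃ Φ' : E → EG G, Classifies π Φ' (fun x => H (x, ρ' x)) ∧ ∀ e, η (π e) = 0 → Φ' e = Φ e := by
  classical
  -- The translate of `s` that meets `Φ e` at time `ρ` is followed to time `ρ'`.
  let tr : E → EG G := fun e => quot G (s (π e, ρ (π e))) (Φ e) • s (π e, ρ' (π e))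
  have hproj : ∀ e, π e ∈ V → universalProj (s (π e, ρ (π e))) = universalProj (Φ e) :=
    fun e he => by rw [hs.proj _ ⟨he, hρI _⟩, h.proj]
  have htr : ∀ e, π e ∈ V → η (π e) = 0 → tr e = Φ e := fun e he h0 => by
    simp only [tr]
    rw [hρη _ h0, universalCore.quot_smul (hproj e he)]
  have hη0 : ∀ x, x ∉ V → η x = 0 := fun x hx => by
    by_contra h0
    exact hx (hη (@subset_closure X dTopology {x | η x ≠ 0} x h0))
  refine ⟨fun e => if π e ∈ V then tr e else Φ e, ⟨fun n p hp => isPlot_of_plotAt fun x => ?_,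
    fun g e => ?_, fun e => ?_⟩, fun e he => ?_⟩
  · have hπp := hπ.smooth n p hp
    by_cases hx : π (p x) ∈ V
    · have h1 := hs.smoothOn n (fun y => (π (p y), ρ (π (p y)))) ⟨hπp, hρ n _ hπp⟩ x
        ⟨hx, hρI _⟩
      have h2 := hs.smoothOn n (fun y => (π (p y), ρ' (π (p y)))) ⟨hπp, hρ' n _ hπp⟩ x
        ⟨hx, hρI' _⟩
      have hxV := eventually_mem_of_isPlot hπp hV hx
      refine (universalCore.plotAt_smul (universalCore.plotAt_quot h1
        (plotAt_of_isPlot (h.smooth n p hp) x) (hxV.mono fun y hy => hproj _ hy)) h2).congr ?_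
      filter_upwards [hxV] with y hy
      exact if_pos hy
    -- Off `V` the closed support of `η` is avoided, so nearby the two times agree and nothing is
    -- moved, even at points of `V`.
    · refine (plotAt_of_isPlot (h.smooth n p hp) x).congr ?_
      filter_upwards [eventually_eq_zero_of_notMem_dSupport hπp fun h => hx (hη h)] with y hy
      simp only [Function.comp_apply]
      split_ifs with h1
      · exact htr _ h1 hy
      · rfl
  · simp only [hπ.proj_smul]
    split_ifs with h1
    · simp only [tr, hπ.proj_smul, h.map_smul]
      rw [universalCore.quot_smul_right (hproj e h1), mul_smul]
    · exact h.map_smul g e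
  · split_ifs with h1
    · exact (universalProj_smul _ _).trans (hs.proj _ ⟨h1, hρI' _⟩)
    · rw [h.proj, hρη _ (hη0 _ h1)]
  · simp only
    split_ifs with h1
    · exact htr e h1 he
    · rfl

/-- A principal bundle classified by one end of a homotopy is classified by the other end. -/
theorem PrincipalCore.exists_classifies_of_homotopy (hπ : PrincipalCore G π)
    (hX : SmoothlyParacompact X) (hX2 : @SecondCountableTopology X dTopology) {H : X × ℝ → BG G}
    (hH : DSmooth H) {Φ : E → EG G} (h : Classifies π Φ fun x => H (x, 0)) :
    ∃ Φ' : E → EG G, Classifies π Φ' fun x => H (x, 1) := by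
  rcases isEmpty_or_nonempty X with hXe | hXn
  · exact ⟨Φ, h.smooth, h.map_smul, fun e => isEmptyElim (π e)⟩
  choose U hU hxU s hs using exists_isLiftOn hH
  obtain ⟨v, hv⟩ : ∃ v : ℕ → X, ⋃ n, U (v n) = Set.univ := by
    let _ : TopologicalSpace X := dTopology
    obtain ⟨S, hS, hSU⟩ := TopologicalSpace.countable_cover_nhds fun x => (hU x).mem_nhds (hxU x)
    have hSn : S.Nonempty := by
      by_contra h0
      rw [Set.not_nonempty_iff_eq_empty] at h0
      subst h0
      simp only [Set.biUnion_empty] at hSU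
      exact Set.empty_ne_univ hSU
    obtain ⟨v, rfl⟩ := hS.exists_eq_range hSn
    exact ⟨v, by simpa using hSU⟩
  obtain ⟨η, hη, hfin, hsupp⟩ := hX.exists_nat_partition (fun n => hU (v n)) hv
  -- The times rise from `0` to `1`, and stage `n` changes them only within the support of `η n`,
  -- where a lift is known.
  let ρ : ℕ → X → ℝ := fun n x => ∑ k ∈ Finset.range n, η k x
  have hρ : ∀ n, DSmooth (ρ n) := fun n => smooth_sum hη.smooth _
  have hρI : ∀ n x, ρ n x ∈ Set.Icc (0 : ℝ) 1 := fun n x =>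
    ⟨Finset.sum_nonneg fun k _ => hη.nonneg k x, (hη.isWeight x).sum_range_le_one n⟩
  choose! step hstep hstep' using fun n (Φ : E → EG G)
    (h : Classifies π Φ fun x => H (x, ρ n x)) => hπ.exists_transport (hU (v n)) (hs (v n))
      (hsupp n) (hρ n) (hρ (n + 1)) (hρI n) (hρI (n + 1))
      (fun x hx => by simp only [ρ, Finset.sum_range_succ, hx, add_zero]) h
  let Θ : ℕ → E → EG G := fun n => Nat.rec Φ step n
  have hΘ : ∀ n, Classifies π (Θ n) fun x => H (x, ρ n x) := fun n => by
    induction n with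
    | zero =>
      have h0 : (fun x => H (x, ρ 0 x)) = fun x => H (x, 0) := by simp [ρ]
      rwa [h0]
    | succ n ih => exact hstep n _ ih
  have hΘm : ∀ (m : ℕ) (e : E), (∀ k, m ≤ k → η k (π e) = 0) → ∀ n, m ≤ n → Θ n e = Θ m e :=
    fun m e hm n hn => by
      induction n, hn using Nat.le_induction with
      | base => rfl
      | succ n hn ih => exact (hstep' n _ (hΘ n) e (hm n hn)).trans ih
  have hN : ∀ x, ∃ m, ∀ k, m ≤ k → η k x = 0 := fun x => by
    obtain ⟨m, hm⟩ := (hη.pointFinite x).bddAbove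
    refine ⟨m + 1, fun k hk => ?_⟩
    by_contra h0
    exact absurd (hm h0) (by omega)
  -- The limit is read off at a stage after which nothing happens over the given point. The stage
  -- may jump with the point, but by `hΘN` any late enough stage gives the same value.
  choose N hN using hN
  have hΘN : ∀ (m : ℕ) (e : E), (∀ k, m ≤ k → η k (π e) = 0) → Θ (N (π e)) e = Θ m e :=
    fun m e hm => (hΘm _ e (hN _) _ (le_max_left _ m)).symm.trans (hΘm m e hm _ (le_max_right _ _))
  refine ⟨fun e => Θ (N (π e)) e, fun n p hp => isPlot_of_plotAt fun x => ?_, fun g e => ?_,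
    fun e => ?_⟩
  -- By local finiteness a single stage computes the limit near `x`.
  · obtain ⟨I, hI, hIx⟩ := eventually_finite_of_locallyFinite hfin (hπ.smooth n p hp) x
    obtain ⟨m, hm⟩ := hI.bddAbove
    refine (plotAt_of_isPlot ((hΘ (m + 1)).smooth n p hp) x).congr ?_
    filter_upwards [hIx] with y hy
    refine hΘN (m + 1) (p y) fun k hk => ?_
    by_contra h0
    exact absurd (hm (hy k h0)) (by omega)
  · simp only [hπ.proj_smul]
    exact (hΘ _).map_smul g e
  · rw [(hΘ _).proj]
    simp only [ρ, (hη.isWeight (π e)).sum_range_eq_one (hN (π e))]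

end Cover

/-! ### The classification theorem -/

section Classification

variable (G : Type u) [Group G] [DiffeologicalSpace G] [DiffeologicalGroup G]

theorem DNumerableBundle.equiv_of_classifies {X : Type u} [DiffeologicalSpace X]
    {P Q : DNumerableBundle G X} {Φ : P.total → EG G} {Φ' : Q.total → EG G} {f : X → BG G}
    (h : Classifies P.proj Φ f) (h' : Classifies Q.proj Φ' f) : P ≈ Q :=
  P.isPrincipal.core.exists_iso Q.isPrincipal.core h h'

/-- The isomorphism class of the bundle pulled back along a smooth map to `BG`. -/
noncomputable def classOfMap {X : Diffeol.{u}} (hX : isHSP X) :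
    HomotopyClasses X.carrier (BG G) → BundleClasses G X.carrier :=
  Quot.lift (fun f => Quotient.mk _ (universalPullback hX.2.2 f.2)) (by
    rintro f f' ⟨H, hH, h0, h1⟩
    -- The tautological map of `f^*EG`, transported along `H`, classifies it over `f'`; it then has
    -- the same classifying map as `f'^*EG`.
    have h : Classifies (universalPullback hX.2.2 f.2).proj
        (fun z : Pullback f.1 (universalProj : EG G → BG G) => z.1.2) fun x => H (x, 0) := by
      rw [show (fun x => H (x, 0)) = f.1 from funext h0]
      exact classifies_universalPullback hX.2.2 f.2
    obtain ⟨Φ, hΦ⟩ :=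
      (universalPullback hX.2.2 f.2).isPrincipal.core.exists_classifies_of_homotopy
        hX.2.2 hX.2.1 hH h
    rw [show (fun x => H (x, 1)) = f'.1 from funext h1] at hΦ
    exact Quotient.sound (DNumerableBundle.equiv_of_classifies G hΦ
      (classifies_universalPullback hX.2.2 f'.2)))

/-- An isomorphism `f^*EG ≅ f'^*EG` gives the first bundle a second classifying map, over `f'`, so
uniqueness up to homotopy yields injectivity. Surjectivity is the existence of classifying maps of
D-numerable bundles. -/
theorem classOfMap_bijective {X : Diffeol.{u}} (hX : isHSP X) :
    Function.Bijective (classOfMap G hX) := by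
  constructor
  · rintro ⟨f⟩ ⟨f'⟩ hff
    obtain ⟨F, hF, hFG⟩ := Quotient.exact hff
    have h' := (classifies_universalPullback hX.2.2 f'.2).comp (k := id) F.smooth_toFun hFG hF
    exact (universalPullback hX.2.2 f.2).isPrincipal.core.homotopyClass_eq hX.2.2
      (classifies_universalPullback hX.2.2 f.2) h'
  · rintro ⟨P⟩
    obtain ⟨Φ, f, hf, h⟩ := P.isPrincipal.core.exists_classifies_of_isDNumerable P.isDNumerable
    exact ⟨Quot.mk _ ⟨f, hf⟩, Quotient.sound (DNumerableBundle.equiv_of_classifies G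
      (classifies_universalPullback hX.2.2 hf) h)⟩

/-- Both bundles are classified by `f ∘ φ`. -/
theorem classOfMap_precomp {X Y : Diffeol.{u}} (hX : isHSP X) (hY : isHSP Y)
    {φ : Y.carrier → X.carrier} (hφ : DSmooth φ) (c : HomotopyClasses X.carrier (BG G)) :
    classOfMap G hY (HomotopyClasses.precomp φ hφ c) =
      BundleClasses.pullback φ hφ (classOfMap G hX c) := by
  obtain ⟨f⟩ := c
  refine Quotient.sound (DNumerableBundle.equiv_of_classifies G
    (classifies_universalPullback hY.2.2 (f.2.comp hφ)) (f := fun y => f.1 (φ y))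
    ((classifies_universalPullback hX.2.2 f.2).comp (k := φ)
      (F := fun z : ((universalPullback hX.2.2 f.2).pullback φ hφ).total => z.1.2)
      (smooth_snd.comp smooth_val) (fun _ _ => rfl) fun z => z.2.symm))

end Classification

end MilnorBG

theorem theoremt (G : Type u) [Group G] [DiffeologicalSpace G] [MilnorBG.DiffeologicalGroup G] :
    Nonempty
      ((MilnorBG.isHSP.{u}.ι.op ⋙ MilnorBG.bundleFunctor G) ≅
        (MilnorBG.isHSP.{u}.ι.op ⋙ MilnorBG.homotopyFunctor (MilnorBG.BG G) ⋙
          uliftFunctor.{u + 1, u})) := by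
  -- The isomorphism is built from maps to bundles and then inverted; homotopy classes are lifted to
  -- the larger universe of bundle classes.
  refine ⟨(NatIso.ofComponents (fun X => ((Equiv.ulift.trans (Equiv.ofBijective _
    (MilnorBG.classOfMap_bijective G X.unop.property))).toIso)) ?_).symm⟩
  intro X Y f
  ext ⟨c⟩
  exact MilnorBG.classOfMap_precomp G X.unop.property Y.unop.property f.unop.hom.2 c
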